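/- Let $N\ge 1$, write $x=(x_1,x')\in\mathbb R\times\mathbb R^{N-1}$, and let $J:\mathbb R^N\setminus\{0\}\to[0,\infty)$ be measurable and even, with (J1) $\displaystyle \int_{\mathbb R^N\setminus B_1(0)}J(z)\,dz+\int_{B_1(0)}|z|^2J(z)\,dz<\infty$ and $\displaystyle \int_{\mathbb R^N}J(z)\,dz=\infty$; (J2) $J(s,z')>J(t,z')$ for all $z'\in\mathbb R^{N-1}$ and $s,t\in\mathbb R$ with $|s|<|t|$ and $(s,z')\neq 0$. Let $\Omega\subset\mathbb R^N$ be open, bounded and Steiner symmetric in $x_1$, i.e. $(sx_1,x')\in\Omega$ for all $x\in\Omega$, $s\in[-1,1]$. Let $f:\Omega\times\mathbb R\to\mathbb R$ satisfy (F1) $f$ is a Carathéodory function, and for every bounded $K\subset\mathbb R$ there is $L>0$ with $\sup_{x\in\Omega}|f(x,\sigma)-f(x,\tau)|\le L|\sigma-\tau|$ for all $\sigma,\tau\in K$; (F2) $f(sx_1,x',\tau)\ge f(x,\tau)$ for all $\tau\in\mathbb R$, $x\in\Omega$, $s\in[-1,1]$. Put $\mathcal J(u,v)=\frac12\int_{\mathbb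 R^N}\int_{\mathbb R^N}(u(x)-u(y))(v(x)-v(y))J(x-y)\,dx\,dy$, and let $\mathcal D(\Omega)$ be the set of measurable $u:\mathbb R^N\to\mathbb R$ with $\mathcal J(u,u)<\infty$ and $u=0$ a.e. on $\mathbb R^N\setminus\Omega$. A function $u\in\mathcal D(\Omega)$ is called a solution of $$(P)\qquad Iu=f(x,u)\ \text{ in }\Omega,\qquad u=0\ \text{ on }\mathbb R^N\setminus\Omega,$$ where $I$ is the nonlocal operator associated with $\mathcal J$, if for all $\varphi\in\mathcal D(\Omega)$ the integral $\int_\Omega f(x,u(x))\varphi(x)\,dx$ exists and $$\mathcal J(u,\varphi)=\int_\Omega f(x,u(x))\varphi(x)\,dx .$$ Then every nonnegative solution $u\in L^\infty(\Omega)\cap\mathcal D(\Omega)$ of (P) is symmetric in $x_1$, i.e. $u(-x_1,x')=u(x_1,x')$ for a.e. $x\in\Omega$. Moreover, either $u=0$ a.e. in $\mathbb R^N$, or both of the following hold: (a) $u$ is strictly decreasing in $|x_1|$, i.e. for every $\lambda\in\mathbb R\setminus\{0\}$ and every compact $K\subset\{x\in\Omega: x_1/\lambda>1\}$, $$\operatorname*{ess\,inf}_{x\in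 K}\bigl[u(2\lambda-x_1,x')-u(x)\bigr]>0;$$ (b) $\operatorname*{ess\,inf}_K u>0$ for every compact $K\subset\Omega$. (The essential infimum over a null set is $+\infty$.) -/

import Mathlib

open MeasureTheory
open scoped ENNReal

noncomputable section

namespace NonlocalSymmetry

/-- Euclidean space `ℝ^N` with `N = n + 1 ≥ 1`; the coordinate `x₁` of the text is `x 0`. -/
abbrev E (n : ℕ) : Type := EuclideanSpace ℝ (Fin (n + 1))

/-- The point `(t, x')`, where `x = (x₁, x')`. -/
def withFirst {n : ℕ} (t : ℝ) (x : E n) : E n :=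
  WithLp.toLp 2 (Function.update x.ofLp 0 t)

/-- An even measurable kernel `J : ℝ^N \ {0} → [0, ∞)`. The value `J 0` is arbitrary and is
never used: the conditions below do not see it, and it does not affect any integral. -/
structure IsEvenKernel {n : ℕ} (J : E n → ℝ) : Prop where
  aemeasurable : AEMeasurable J volume
  nonneg : ∀ z, z ≠ 0 → 0 ≤ J z
  even : ∀ z, z ≠ 0 → J (-z) = J z

/-- Condition (J1). -/
def CondJ1 {n : ℕ} (J : E n → ℝ) : Prop :=
  (∫⁻ z in (Metric.ball (0 : E n) 1)ᶜ, ENNReal.ofReal (J z)) +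
      (∫⁻ z in Metric.ball (0 : E n) 1, ENNReal.ofReal (‖z‖ ^ 2 * J z)) < ∞ ∧
    ∫⁻ z, ENNReal.ofReal (J z) = ∞

/-- Condition (J2): `J (s, z') > J (t, z')` whenever `|s| < |t|`
(and `(s, z') ≠ 0`, so that both sides are defined). -/
def CondJ2 {n : ℕ} (J : E n → ℝ) : Prop :=
  ∀ (z : E n) (s t : ℝ), |s| < |t| → withFirst s z ≠ 0 → J (withFirst t z) < J (withFirst s z)

/-- Condition (D): `Ω` is open, bounded and Steiner symmetric in `x₁`. -/
structure CondD {n : ℕ} (Ω : Set (E n)) : Prop where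
  isOpen : IsOpen Ω
  isBounded : Bornology.IsBounded Ω
  steiner : ∀ x ∈ Ω, ∀ s ∈ Set.Icc (-1 : ℝ) 1, withFirst (s * x 0) x ∈ Ω

/-- Condition (F1): `f : Ω × ℝ → ℝ` is a Carathéodory function which is locally Lipschitz in the
second variable, uniformly in `x ∈ Ω`. Only the values of `f x` with `x ∈ Ω` are used. -/
structure CondF1 {n : ℕ} (Ω : Set (E n)) (f : E n → ℝ → ℝ) : Prop where
  aemeasurable : ∀ τ : ℝ, AEMeasurable (fun x => f x τ) (volume.restrict Ω)
  continuous : ∀ᵐ x ∂(volume.restrict Ω), Continuous (f x)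
  lipschitz : ∀ K : Set ℝ, Bornology.IsBounded K →
    ∃ L : ℝ, 0 < L ∧ ∀ x ∈ Ω, ∀ σ ∈ K, ∀ τ ∈ K, |f x σ - f x τ| ≤ L * |σ - τ|

/-- Condition (F2): `f` is symmetric and monotone in `x₁`. -/
def CondF2 {n : ℕ} (Ω : Set (E n)) (f : E n → ℝ → ℝ) : Prop :=
  ∀ τ : ℝ, ∀ x ∈ Ω, ∀ s ∈ Set.Icc (-1 : ℝ) 1, f x τ ≤ f (withFirst (s * x 0) x) τ

/-- The quadratic form `𝒥(u, u) = ½ ∬ (u x - u y)² J (x - y) dx dy`, with values in `[0, ∞]`. -/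
def energy {n : ℕ} (J : E n → ℝ) (u : E n → ℝ) : ℝ≥0∞ :=
  (1 / 2) * ∫⁻ p : E n × E n, ENNReal.ofReal ((u p.1 - u p.2) ^ 2 * J (p.1 - p.2))

/-- The bilinear form `𝒥(u, v) = ½ ∬ (u x - u y) (v x - v y) J (x - y) dx dy`. If `u` and `v` are
measurable and have finite energy then the integrand is integrable on `ℝ^N × ℝ^N`. -/
def form {n : ℕ} (J : E n → ℝ) (u v : E n → ℝ) : ℝ :=
  (1 / 2) * ∫ p : E n × E n, (u p.1 - u p.2) * (v p.1 - v p.2) * J (p.1 - p.2)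

/-- The form domain `𝒟(Ω)`: (Lebesgue) measurable functions on `ℝ^N` of finite energy which
vanish almost everywhere outside `Ω`. -/
def formDomain {n : ℕ} (J : E n → ℝ) (Ω : Set (E n)) : Set (E n → ℝ) :=
  {u | AEMeasurable u volume ∧ energy J u < ∞ ∧ ∀ᵐ x, x ∉ Ω → u x = 0}

/-- `u ∈ 𝒟(Ω)` is a (weak) solution of `I u = f(x, u)` in `Ω`, `u = 0` on `ℝ^N \ Ω`. -/
structure IsSolution {n : ℕ} (J : E n → ℝ) (Ω : Set (E n)) (f : E n → ℝ → ℝ)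
    (u : E n → ℝ) : Prop where
  mem : u ∈ formDomain J Ω
  integrable : ∀ φ ∈ formDomain J Ω, IntegrableOn (fun x => f x (u x) * φ x) Ω
  eq : ∀ φ ∈ formDomain J Ω, form J u φ = ∫ x in Ω, f x (u x) * φ x

/-- `ess inf_K g > 0`, that is, `g` is bounded below a.e. on `K` by a positive constant
(so the essential infimum over a null set counts as `+∞`). -/
def EssInfPos {n : ℕ} (K : Set (E n)) (g : E n → ℝ) : Prop :=
  ∃ c : ℝ, 0 < c ∧ ∀ᵐ x ∂(volume.restrict K), c ≤ g x

/-- `u` is symmetric in `x₁`. -/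
def IsSymmetric {n : ℕ} (Ω : Set (E n)) (u : E n → ℝ) : Prop :=
  ∀ᵐ x ∂(volume.restrict Ω), u (withFirst (-(x 0)) x) = u x

/-- `u` is strictly decreasing in `|x₁|`. -/
def IsStrictlyDecreasing {n : ℕ} (Ω : Set (E n)) (u : E n → ℝ) : Prop :=
  ∀ lam : ℝ, lam ≠ 0 → ∀ K : Set (E n), IsCompact K → K ⊆ {x | x ∈ Ω ∧ 1 < x 0 / lam} →
    EssInfPos K (fun x => u (withFirst (2 * lam - x 0) x) - u x)

end NonlocalSymmetry

end

/-!
The proof is the moving plane method for weak solutions. Write `Q` for the reflection at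
`{x₁ = l}` and `H` for the half space `{x₁ > l}`. For `l ≥ 0` the difference `w = u ∘ Q - u` is
antisymmetric, and testing the equation with `φ` and `φ ∘ Q`, where `φ ≥ 0` is supported in
`Ω ∩ H`, gives `𝒥(w, φ) ≥ -L ∫ |w| φ` by (F1) and (F2)
(`IsSolution.isReflectionSuper`). From then on `f` plays no role.

Two maximum principles for antisymmetric functions drive the argument. Both rest on the
inequality `𝒥(W, v) ≤ -𝒥(v, v)` for an antisymmetric `W` and `v = W⁻ 1_H`
(`NiceKernel.integral_inc_add_nonpos`), which holds pointwise after summation over the four pairs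
of reflected points because `J (x - Q y) < J (x - y)` for `x, y ∈ H` by (J2).

* Small volume: as `J` is not integrable, `𝒥(v, v) ≥ κ ∫ v²` with `κ` as large as desired if the
  support of `v` has small measure (`NiceKernel.exists_energy_ge`), so that the subset
  of `H` where `w < 0` is a null set as soon as it has small measure
  (`IsReflectionSuper.exists_reflectLE_of_measure_le`).
* Strong maximum principle (`NiceKernel.strong_maximum_principle`): if `w ≥ 0` in `H` does not
  vanish identically, then it is bounded away from zero near each point of `Ω ∩ H`. The barrier is
  a small multiple of the antisymmetrization of `f + a 1_A`, where `f` is the truncated paraboloid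
  `(r² - |x - x₀|²)⁺` and `w` is bounded below on `A`. The paraboloid is semiconvex, which bounds
  the operator on it from above, and the strict inequality between the kernels makes the
  contribution of `A` a negative one that dominates for large `a`.

The planes start beyond `Ω`, and the set of good `l > 0` is closed and, by the two principles,
open to the left unless `w` vanishes for some `l > 0`. In that case `u = 0` in a neighbourhood of
one end of `Ω`; applying the strong maximum principle to the mirror image of `u` and a hyperplane
close to the opposite end yields `u = 0` (`IsReflectionSuper.ae_eq_zero_of_reflect_eq`). Otherwise
the planes reach `{x₁ = 0}` from both sides, which gives the symmetry; the strong maximum principle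
gives (a), and (b) follows from (a) by reflecting at a hyperplane slightly beyond a given point.

Throughout, `J` and `u` are replaced by representatives with better pointwise properties
(`exists_niceKernel`, `exists_nice_representative`). In particular (J2) makes `J` invariant under
the reflection at `{x₁ = 0}`, but only almost everywhere (`ae_kernel_reflect`).
-/

open Filter Topology Set

namespace NonlocalSymmetry

/-! ### Reflections at the hyperplanes `x₁ = l` -/

/-- The reflection at the hyperplane `{x₁ = 0}`, as a linear isometry. -/
noncomputable def reflectLinear (n : ℕ) : E n ≃ₗᵢ[ℝ] E n :=
  LinearIsometryEquiv.piLpCongrRight 2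
    (fun i => if i = 0 then LinearIsometryEquiv.neg ℝ else LinearIsometryEquiv.refl ℝ ℝ)

/-- The reflection at the hyperplane `{x₁ = l}`. -/
noncomputable def reflect {n : ℕ} (l : ℝ) (x : E n) : E n := withFirst (2 * l - x 0) x

variable {n : ℕ}

@[simp] lemma withFirst_zero (t : ℝ) (x : E n) : withFirst t x 0 = t := by
  simp [withFirst]

lemma withFirst_of_ne (t : ℝ) (x : E n) {i : Fin (n + 1)} (hi : i ≠ 0) :
    withFirst t x i = x i := by
  simp [withFirst, hi]

@[simp] lemma withFirst_self (x : E n) : withFirst (x 0) x = x := by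
  ext i
  by_cases hi : i = 0
  · subst hi; simp
  · simp [withFirst_of_ne _ _ hi]

@[simp] lemma withFirst_withFirst (s t : ℝ) (x : E n) :
    withFirst s (withFirst t x) = withFirst s x := by
  ext i
  by_cases hi : i = 0
  · subst hi; simp
  · simp [withFirst_of_ne _ _ hi]

@[simp] lemma reflect_apply_zero (l : ℝ) (x : E n) : reflect l x 0 = 2 * l - x 0 := by
  simp [reflect]

lemma reflect_of_ne (l : ℝ) (x : E n) {i : Fin (n + 1)} (hi : i ≠ 0) : reflect l x i = x i :=
  withFirst_of_ne _ _ hi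

@[simp] lemma reflect_reflect (l : ℝ) (x : E n) : reflect l (reflect l x) = x := by
  simp [reflect]

lemma reflect_involutive (l : ℝ) : Function.Involutive (reflect (n := n) l) := reflect_reflect l

lemma reflectLinear_apply (x : E n) : reflectLinear n x = reflect 0 x := by
  ext i
  by_cases hi : i = 0
  · subst hi; simp [reflectLinear]
  · simp [reflectLinear, reflect_of_ne _ _ hi, hi]

/-- The unit vector in the direction `x₁`. -/
noncomputable def e₁ (n : ℕ) : E n := EuclideanSpace.single 0 1

@[simp] lemma e₁_zero : e₁ n 0 = 1 := by simp [e₁]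

lemma e₁_of_ne {i : Fin (n + 1)} (hi : i ≠ 0) : e₁ n i = 0 := by simp [e₁, hi]

lemma reflect_eq_add (l : ℝ) (x : E n) : reflect l x = reflect 0 x + (2 * l) • e₁ n := by
  ext i
  by_cases hi : i = 0
  · subst hi; simp; ring
  · simp [reflect_of_ne _ _ hi, e₁_of_ne hi]

lemma reflect_sub_reflect (l : ℝ) (x y : E n) : reflect l x - reflect l y = reflect 0 (x - y) := by
  ext i
  by_cases hi : i = 0
  · subst hi; simp
  · simp [reflect_of_ne _ _ hi]

lemma sub_reflect (l : ℝ) (x y : E n) :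
    x - reflect l y = withFirst (x 0 + y 0 - 2 * l) (x - y) := by
  ext i
  by_cases hi : i = 0
  · subst hi; simp; ring
  · simp [reflect_of_ne _ _ hi, withFirst_of_ne _ _ hi]

/-- Reflecting either of the two points changes their difference in the same way, up to a
reflection of the difference. -/
lemma reflect_sub (l : ℝ) (x y : E n) : reflect l x - y = reflect 0 (x - reflect l y) := by
  rw [← reflect_sub_reflect l, reflect_reflect]

lemma reflect_neg (x : E n) : reflect 0 (-x) = - reflect 0 x := by
  simp only [← reflectLinear_apply, map_neg]

lemma continuous_reflect (l : ℝ) : Continuous (reflect (n := n) l) := by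
  have : reflect (n := n) l = fun x => reflectLinear n x + (2 * l) • e₁ n := by
    ext1 x; rw [reflect_eq_add, reflectLinear_apply]
  rw [this]; fun_prop

@[fun_prop] lemma measurable_reflect (l : ℝ) : Measurable (reflect (n := n) l) :=
  (continuous_reflect l).measurable

lemma measurePreserving_reflect (l : ℝ) :
    MeasurePreserving (reflect (n := n) l) volume volume := by
  have : reflect (n := n) l = (fun x => x + (2 * l) • e₁ n) ∘ (reflectLinear n) := by
    ext1 x; simp only [Function.comp]; rw [reflect_eq_add, reflectLinear_apply]
  rw [this]
  exact (measurePreserving_add_right _ _).comp (reflectLinear n).measurePreserving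

/-- The reflection at `{x₁ = l}` as a measurable equivalence. -/
noncomputable def reflectEquiv (n : ℕ) (l : ℝ) : E n ≃ᵐ E n where
  toEquiv := (reflect_involutive l).toPerm
  measurable_toFun := measurable_reflect l
  measurable_invFun := measurable_reflect l

lemma measurableEmbedding_reflect (l : ℝ) : MeasurableEmbedding (reflect (n := n) l) :=
  (reflectEquiv n l).measurableEmbedding

lemma ae_reflect {p : E n → Prop} (l : ℝ) (h : ∀ᵐ x, p x) : ∀ᵐ x, p (reflect l x) :=
  (measurePreserving_reflect l).quasiMeasurePreserving.ae h

lemma ae_of_ae_reflect {p : E n → Prop} (l : ℝ) (h : ∀ᵐ x, p (reflect l x)) : ∀ᵐ x, p x := by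
  simpa using ae_reflect l h

lemma ae_neg {p : E n → Prop} (h : ∀ᵐ x, p x) : ∀ᵐ x, p (-x) :=
  (Measure.measurePreserving_neg (volume : Measure (E n))).quasiMeasurePreserving.ae h

lemma integral_comp_reflect (l : ℝ) (g : E n → ℝ) : ∫ x, g (reflect l x) = ∫ x, g x :=
  (measurePreserving_reflect l).integral_comp (measurableEmbedding_reflect l) g

/-- The hyperplane `{x₁ = l}` is a null set. -/
lemma ae_first_ne (l : ℝ) : ∀ᵐ x : E n, x 0 ≠ l := by
  have h2 : ∀ᵐ y : Fin (n + 1) → ℝ, y 0 ≠ l := by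
    rw [volume_pi]
    exact Measure.ae_eval_ne (ι := Fin (n + 1)) (α := fun _ => ℝ) (fun _ => volume) 0 l
  have := (EuclideanSpace.volume_preserving_symm_measurableEquiv_toLp
    (Fin (n + 1))).quasiMeasurePreserving.ae h2
  simpa using this

/-- If a family of measure preserving maps depends continuously on a parameter, then so does, in
`L¹`, the composition of an integrable function with these maps. -/
lemma tendsto_lintegral_enorm_comp_sub {Z : Type*} [TopologicalSpace Z] {G : Z → E n → E n}
    (hG : Continuous (Function.uncurry G)) (hm : ∀ z, MeasurePreserving (G z) volume volume)
    {g : E n → ℝ} (hg : Integrable g) (z₀ : Z) :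
    Tendsto (fun z => ∫⁻ x, ‖g (G z x) - g (G z₀ x)‖ₑ) (𝓝 z₀) (𝓝 0) := by
  have hc : Continuous fun z : Z => (⟨G z, by fun_prop⟩ : C(E n, E n)) :=
    (ContinuousMap.curry ⟨Function.uncurry G, hG⟩).continuous
  have hL : MemLp g 1 := memLp_one_iff_integrable.2 hg
  have h := (continuousAt_const (y := hL.toLp g)).compMeasurePreservingLp (z := z₀)
    hc.continuousAt hm ENNReal.one_ne_top
  have h2 := tendsto_iff_edist_tendsto_0.1 h
  refine h2.congr fun z => ?_
  rw [Lp.edist_def, eLpNorm_one_eq_lintegral_enorm]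
  refine lintegral_congr_ae ?_
  filter_upwards [Lp.coeFn_compMeasurePreserving (hL.toLp g) (hm z),
    Lp.coeFn_compMeasurePreserving (hL.toLp g) (hm z₀),
    (hm z).quasiMeasurePreserving.ae hL.coeFn_toLp,
    (hm z₀).quasiMeasurePreserving.ae hL.coeFn_toLp] with x h1 h2 h3 h4
  simp only [Pi.sub_apply]
  erw [h1, h2]
  simp only [Function.comp, h3, h4]

/-! ### Normalized kernels -/

/-- A kernel with a Borel measurable representative that is nonnegative, even and reflection
invariant *everywhere*, and strictly decreasing in the distance of the first coordinates in the
almost everywhere form needed to compare `J (x - y)` with `J (x - Q y)` for a reflection `Q`. -/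
structure NiceKernel (J : E n → ℝ) : Prop where
  measurable : Measurable J
  nonneg : ∀ z, 0 ≤ J z
  even : ∀ z, J (-z) = J z
  reflect_eq : ∀ z, J (reflect 0 z) = J z
  levy : Integrable fun z => min 1 (‖z‖ ^ 2) * J z
  infinite : ∫⁻ z, ENNReal.ofReal (J z) = ∞
  lt : ∀ l x, l < x 0 → ∀ᵐ y, l < y 0 → J (x - reflect l y) < J (x - y)

lemma ae_ne_zero : ∀ᵐ z : E n, z ≠ 0 := by
  filter_upwards [ae_first_ne (n := n) 0] with z hz h
  simp [h] at hz

/-- By (J2) two points of `{J (reflection of z) < q < J z, z₁ > 0}` are never translates of each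
other in the direction `x₁`, so that the set is null. -/
lemma measure_jump_eq_zero {J : E n → ℝ} (hJ : IsEvenKernel J) (hJ2 : CondJ2 J) (q : ℝ) :
    volume {z : E n | 0 < z 0 ∧ J (reflect 0 z) < q ∧ q < J z} = 0 := by
  set A := {z : E n | 0 < z 0 ∧ J (reflect 0 z) < q ∧ q < J z} with hA
  have hnull : NullMeasurableSet A := by
    have h1 : NullMeasurableSet {z : E n | 0 < z 0} :=
      (measurableSet_lt measurable_const (by fun_prop)).nullMeasurableSet
    have h2 : NullMeasurableSet {z : E n | J (reflect 0 z) < q} :=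
      nullMeasurableSet_lt (hJ.aemeasurable.comp_quasiMeasurePreserving
        (measurePreserving_reflect 0).quasiMeasurePreserving) aemeasurable_const
    have h3 : NullMeasurableSet {z : E n | q < J z} :=
      nullMeasurableSet_lt aemeasurable_const hJ.aemeasurable
    exact h1.inter (h2.inter h3)
  obtain ⟨T, hTA, hT, hTe⟩ := hnull.exists_measurable_subset_ae_eq
  rw [← measure_congr hTe]
  refine Measure.addHaar_eq_zero_of_disjoint_translates volume
    (fun k : ℕ => (1 / ((k : ℝ) + 1)) • e₁ n) ?_ ?_ hT
  · refine (Metric.isBounded_closedBall (x := (0 : E n)) (r := ‖e₁ n‖)).subset ?_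
    rintro _ ⟨k, rfl⟩
    simp only [Metric.mem_closedBall, dist_zero_right, norm_smul]
    refine mul_le_of_le_one_left (norm_nonneg _) ?_
    rw [Real.norm_of_nonneg (by positivity), div_le_one (by positivity)]
    linarith [(Nat.cast_nonneg k : (0 : ℝ) ≤ k)]
  · -- two points `z` and `z + h e₁`, `h > 0`, cannot both belong to `T`
    have key : ∀ z ∈ T, ∀ h : ℝ, 0 < h → z + h • e₁ n ∉ T := by
      intro z hz h hh hz'
      obtain ⟨z1, z2, -⟩ := hTA hz
      obtain ⟨-, -, z3⟩ := hTA hz'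
      have := hJ2 z (-z 0) (z 0 + h) (by
        rw [abs_neg, abs_of_pos z1, abs_of_pos (by linarith)]; linarith) (by
        intro h0
        have := congrArg (fun w : E n => w 0) h0
        simp at this; linarith)
      have e1 : withFirst (-z 0) z = reflect 0 z := by simp [reflect]
      have e2 : withFirst (z 0 + h) z = z + h • e₁ n := by
        ext i
        by_cases hi : i = 0
        · subst hi; simp
        · simp [withFirst_of_ne _ _ hi, e₁_of_ne hi]
      rw [e1, e2] at this
      linarith
    intro i j hij
    rw [Function.onFun, Set.disjoint_left]
    rintro w hw1 hw2
    rw [Set.singleton_add] at hw1 hw2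
    obtain ⟨a, ha, hwa⟩ := hw1
    obtain ⟨b, hb, hwb⟩ := hw2
    set s := 1 / ((i : ℝ) + 1) with hs
    set t := 1 / ((j : ℝ) + 1) with ht
    have hst : s ≠ t := by
      intro h
      rw [hs, ht, div_eq_div_iff (by positivity) (by positivity)] at h
      exact hij (by exact_mod_cast (by linarith : (i : ℝ) = j))
    simp only at hwa hwb
    have hab : a = b + (t - s) • e₁ n := by
      rw [sub_smul, eq_comm, ← sub_eq_zero]
      rw [← hwb] at hwa
      rw [← sub_eq_zero] at hwa
      rw [← neg_eq_zero, ← hwa]; abel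
    rcases lt_or_gt_of_ne hst with h | h
    · exact key b hb (t - s) (by linarith) (hab ▸ ha)
    · refine key a ha (s - t) (by linarith) ?_
      have : a + (s - t) • e₁ n = b := by rw [hab, add_assoc, ← add_smul]; simp
      rwa [this]

/-- Under (J2) the kernel is invariant under the reflection at `{x₁ = 0}` almost everywhere. -/
lemma ae_kernel_reflect {J : E n → ℝ} (hJ : IsEvenKernel J) (hJ2 : CondJ2 J) :
    ∀ᵐ z, J (reflect 0 z) = J z := by
  have h1 : ∀ᵐ z : E n, ∀ q : ℚ, ¬ (0 < z 0 ∧ J (reflect 0 z) < q ∧ (q : ℝ) < J z) := by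
    rw [ae_all_iff]
    intro q
    have := measure_jump_eq_zero hJ hJ2 q
    rw [ae_iff]
    simpa using this
  have h2 : ∀ᵐ z : E n, 0 < z 0 → J z ≤ J (reflect 0 z) := by
    filter_upwards [h1] with z hz h0
    by_contra! hlt
    obtain ⟨q, hq1, hq2⟩ := exists_rat_btwn hlt
    exact hz q ⟨h0, hq1, hq2⟩
  -- the same for the points with `z₁ < 0`, where `-z` has a positive first coordinate
  have h3 : ∀ᵐ z : E n, z 0 < 0 → J z ≤ J (reflect 0 z) := by
    have : ∀ᵐ z : E n, 0 < (-z) 0 → J (-z) ≤ J (reflect 0 (-z)) := ae_neg h2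
    filter_upwards [this, ae_first_ne 0] with z hz h0 hlt
    have hz0 : z ≠ 0 := by rintro rfl; simp at h0
    have hr0 : reflect 0 z ≠ 0 := by
      intro h; apply h0; have := congrArg (fun w : E n => w 0) h; simpa using this
    have := hz (by simpa using hlt)
    rwa [reflect_neg, hJ.even _ hz0, hJ.even _ hr0] at this
  have h4 : ∀ᵐ z : E n, J z ≤ J (reflect 0 z) := by
    filter_upwards [h2, h3, ae_first_ne 0] with z a b c
    rcases lt_or_gt_of_ne c with h | h
    · exact b h
    · exact a h
  filter_upwards [h4, ae_reflect 0 h4] with z a b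
  rw [reflect_reflect] at b
  exact le_antisymm b a

/-- Almost everywhere, a kernel as in the theorem agrees with a nice one. -/
lemma exists_niceKernel {J : E n → ℝ} (hJ : IsEvenKernel J) (hJ1 : CondJ1 J) (hJ2 : CondJ2 J) :
    ∃ J' : E n → ℝ, NiceKernel J' ∧ J' =ᵐ[volume] J := by
  set g := hJ.aemeasurable.mk J with hg
  have hgm : Measurable g := hJ.aemeasurable.measurable_mk
  have hgJ : ∀ᵐ z, J z = g z := hJ.aemeasurable.ae_eq_mk
  set J' : E n → ℝ := fun z =>
    (|g z| + |g (-z)| + |g (reflect 0 z)| + |g (-(reflect 0 z))|) / 4 with hJ'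
  have hae : J' =ᵐ[volume] J := by
    have hR := ae_kernel_reflect hJ hJ2
    -- the symmetrization agrees with `J` because `J` has the symmetries almost everywhere
    filter_upwards [hgJ, ae_neg hgJ, ae_reflect 0 hgJ, ae_reflect 0 (ae_neg hgJ), hR,
      ae_ne_zero, ae_reflect 0 ae_ne_zero] with z a b c d e f f'
    simp only [hJ', ← a, ← b, ← c, ← d, e, hJ.even z f, hJ.even _ f', abs_of_nonneg (hJ.nonneg z f)]
    ring
  have hm : Measurable J' := by
    simp only [hJ']
    fun_prop
  refine ⟨J', ⟨hm, fun z => by positivity, fun z => ?_, fun z => ?_, ⟨?_, ?_⟩, ?_, ?_⟩, hae⟩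
  · simp only [hJ', reflect_neg, neg_neg]; ring
  · simp only [hJ', reflect_reflect]; ring
  · fun_prop
  · -- the Lévy bound is the first half of (J1), split at the unit sphere
    rw [hasFiniteIntegral_iff_ofReal (ae_of_all _ fun z => by positivity)]
    have hball : MeasurableSet (Metric.ball (0 : E n) 1) := measurableSet_ball
    rw [← lintegral_add_compl _ hball, add_comm]
    refine lt_of_le_of_lt (add_le_add (lintegral_mono_ae ?_) (lintegral_mono_ae ?_)) hJ1.1
    · refine ae_restrict_of_ae ?_
      filter_upwards [hae, ae_ne_zero] with z hz h0
      rw [hz]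
      exact ENNReal.ofReal_le_ofReal (mul_le_of_le_one_left (hJ.nonneg z h0) (min_le_left _ _))
    · refine ae_restrict_of_ae ?_
      filter_upwards [hae, ae_ne_zero] with z hz h0
      rw [hz]
      exact ENNReal.ofReal_le_ofReal
        (mul_le_mul_of_nonneg_right (min_le_right _ _) (hJ.nonneg z h0))
  · rw [← hJ1.2]
    refine lintegral_congr_ae ?_
    filter_upwards [hae] with z hz
    rw [hz]
  · intro l x hx
    have h1 : ∀ᵐ y, J' (x - y) = J (x - y) :=
      (quasiMeasurePreserving_sub_left_of_right_invariant volume x).ae hae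
    have h3 : ∀ᵐ y, x - y ≠ 0 :=
      (quasiMeasurePreserving_sub_left_of_right_invariant volume x).ae ae_ne_zero
    filter_upwards [h1, ae_reflect l h1, h3] with y a b c hy
    rw [a, b, sub_reflect]
    have := hJ2 (x - y) ((x - y) 0) (x 0 + y 0 - 2 * l) (by
      rw [abs_of_pos (a := x 0 + y 0 - 2 * l) (by linarith), abs_lt]
      simp only [PiLp.sub_apply]
      constructor <;> linarith) (by rwa [withFirst_self])
    rwa [withFirst_self] at this


/-! ### The bilinear form -/

/-- The integrand of `2 𝒥(u, v)`. -/
def inc (J u v : E n → ℝ) (p : E n × E n) : ℝ :=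
  (u p.1 - u p.2) * (v p.1 - v p.2) * J (p.1 - p.2)

lemma form_eq (J u v : E n → ℝ) : form J u v = (1 / 2) * ∫ p, inc J u v p := rfl

lemma energy_eq (J u : E n → ℝ) :
    energy J u = (1 / 2) * ∫⁻ p, ENNReal.ofReal (inc J u u p) := by
  simp only [energy, inc, sq]

lemma ae_fst {p : E n → Prop} (h : ∀ᵐ x, p x) : ∀ᵐ z : E n × E n, p z.1 :=
  Measure.quasiMeasurePreserving_fst.ae h

lemma ae_snd {p : E n → Prop} (h : ∀ᵐ x, p x) : ∀ᵐ z : E n × E n, p z.2 :=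
  Measure.quasiMeasurePreserving_snd.ae h

lemma ae_sub {p : E n → Prop} (h : ∀ᵐ x, p x) : ∀ᵐ z : E n × E n, p (z.1 - z.2) :=
  (quasiMeasurePreserving_sub_of_right_invariant volume volume).ae h

lemma inc_congr {J J' u u' v v' : E n → ℝ} (hJ : J =ᵐ[volume] J') (hu : u =ᵐ[volume] u')
    (hv : v =ᵐ[volume] v') : inc J u v =ᵐ[volume] inc J' u' v' := by
  filter_upwards [ae_sub hJ, ae_fst hu, ae_snd hu, ae_fst hv, ae_snd hv] with p a b c d e
  simp only [inc, a, b, c, d, e]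

lemma form_congr {J J' u u' v v' : E n → ℝ} (hJ : J =ᵐ[volume] J') (hu : u =ᵐ[volume] u')
    (hv : v =ᵐ[volume] v') : form J u v = form J' u' v' := by
  rw [form_eq, form_eq, integral_congr_ae (inc_congr hJ hu hv)]

lemma energy_congr {J J' u u' : E n → ℝ} (hJ : J =ᵐ[volume] J') (hu : u =ᵐ[volume] u') :
    energy J u = energy J' u' := by
  rw [energy_eq, energy_eq]
  congr 1
  refine lintegral_congr_ae ?_
  filter_upwards [inc_congr hJ hu hu] with p hp
  rw [hp]

lemma measurePreserving_reflect_fst (l : ℝ) :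
    MeasurePreserving (fun p : E n × E n => (reflect l p.1, p.2)) volume volume :=
  (measurePreserving_reflect l).prod (MeasurePreserving.id volume)

lemma measurePreserving_reflect_snd (l : ℝ) :
    MeasurePreserving (fun p : E n × E n => (p.1, reflect l p.2)) volume volume :=
  (MeasurePreserving.id volume).prod (measurePreserving_reflect l)

lemma measurableEmbedding_reflect_fst (l : ℝ) :
    MeasurableEmbedding (fun p : E n × E n => (reflect l p.1, p.2)) :=
  ((reflectEquiv n l).prodCongr (MeasurableEquiv.refl (E n))).measurableEmbedding

lemma measurableEmbedding_reflect_snd (l : ℝ) :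
    MeasurableEmbedding (fun p : E n × E n => (p.1, reflect l p.2)) :=
  ((MeasurableEquiv.refl (E n)).prodCongr (reflectEquiv n l)).measurableEmbedding

namespace NiceKernel

variable {J : E n → ℝ}

lemma measurable_inc (hJ : NiceKernel J) {u v : E n → ℝ} (hu : Measurable u) (hv : Measurable v) :
    Measurable (inc J u v) := by
  have := hJ.measurable
  unfold inc
  fun_prop

lemma inc_self_nonneg (hJ : NiceKernel J) (u : E n → ℝ) (p : E n × E n) : 0 ≤ inc J u u p :=
  mul_nonneg (mul_self_nonneg _) (hJ.nonneg _)

lemma energy_lt_top_iff (hJ : NiceKernel J) {u : E n → ℝ} (hu : Measurable u) :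
    energy J u < ∞ ↔ Integrable (inc J u u) := by
  rw [energy_eq, Integrable, and_iff_right (hJ.measurable_inc hu hu).aestronglyMeasurable,
    hasFiniteIntegral_iff_ofReal (ae_of_all _ (hJ.inc_self_nonneg u))]
  constructor
  · intro h
    by_contra! h2
    rw [top_le_iff.1 h2, ENNReal.mul_top (by simp)] at h
    exact lt_irrefl _ h
  · exact fun h => ENNReal.mul_lt_top (by simp) h

lemma energy_eq_ofReal (hJ : NiceKernel J) {u : E n → ℝ} (hi : Integrable (inc J u u)) :
    energy J u = ENNReal.ofReal (form J u u) := by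
  rw [energy_eq, form_eq, ← ofReal_integral_eq_lintegral_ofReal hi
    (ae_of_all _ (hJ.inc_self_nonneg u)), ENNReal.ofReal_mul (by norm_num)]
  congr 1
  rw [ENNReal.ofReal_div_of_pos (by norm_num)]
  simp

lemma integrable_inc (hJ : NiceKernel J) {u v : E n → ℝ} (hu : Measurable u) (hv : Measurable v)
    (hu' : energy J u < ∞) (hv' : energy J v < ∞) : Integrable (inc J u v) := by
  rw [hJ.energy_lt_top_iff hu] at hu'
  rw [hJ.energy_lt_top_iff hv] at hv'
  refine (hu'.add hv').mono' (hJ.measurable_inc hu hv).aestronglyMeasurable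
    (ae_of_all _ fun p => ?_)
  simp only [inc, Pi.add_apply, Real.norm_eq_abs, abs_mul, abs_of_nonneg (hJ.nonneg _),
    ← add_mul]
  refine mul_le_mul_of_nonneg_right ?_ (hJ.nonneg _)
  rw [← abs_mul_abs_self (u p.1 - u p.2), ← abs_mul_abs_self (v p.1 - v p.2)]
  nlinarith [sq_nonneg (|u p.1 - u p.2| - |v p.1 - v p.2|), abs_nonneg (u p.1 - u p.2),
    abs_nonneg (v p.1 - v p.2)]

lemma energy_add_lt_top (hJ : NiceKernel J) {u v : E n → ℝ} (hu : Measurable u)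
    (hv : Measurable v) (hu' : energy J u < ∞) (hv' : energy J v < ∞) (a b : ℝ) :
    energy J (fun x => a * u x + b * v x) < ∞ := by
  rw [hJ.energy_lt_top_iff (by fun_prop)]
  have h1 := (hJ.energy_lt_top_iff hu).1 hu'
  have h2 := (hJ.energy_lt_top_iff hv).1 hv'
  have h3 := hJ.integrable_inc hu hv hu' hv'
  refine (((h1.const_mul (a ^ 2)).add (h2.const_mul (b ^ 2))).add
    (h3.const_mul (2 * a * b))).congr (ae_of_all _ fun p => ?_)
  simp only [inc, Pi.add_apply]
  ring

lemma kernel_reflect_sub_reflect (hJ : NiceKernel J) (l : ℝ) (x y : E n) :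
    J (reflect l x - reflect l y) = J (x - y) := by
  rw [reflect_sub_reflect, hJ.reflect_eq]

lemma kernel_reflect_sub (hJ : NiceKernel J) (l : ℝ) (x y : E n) :
    J (reflect l x - y) = J (x - reflect l y) := by
  rw [reflect_sub, hJ.reflect_eq]

lemma ae_lt (hJ : NiceKernel J) (l : ℝ) : ∀ᵐ p : E n × E n, l < p.1 0 → l < p.2 0 →
    J (p.1 - reflect l p.2) < J (p.1 - p.2) := by
  have hm := hJ.measurable
  have hs : MeasurableSet {p : E n × E n | l < p.1 0 → l < p.2 0 →
      J (p.1 - reflect l p.2) < J (p.1 - p.2)} := by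
    have h1 : MeasurableSet {p : E n × E n | l < p.1 0} :=
      measurableSet_lt measurable_const (by fun_prop)
    have h2 : MeasurableSet {p : E n × E n | l < p.2 0} :=
      measurableSet_lt measurable_const (by fun_prop)
    have h3 : MeasurableSet {p : E n × E n | J (p.1 - reflect l p.2) < J (p.1 - p.2)} :=
      measurableSet_lt (by fun_prop) (by fun_prop)
    exact h1.imp (h2.imp h3)
  refine (Measure.ae_prod_iff_ae_ae hs).2 (ae_of_all _ fun x => ?_)
  by_cases hx : l < x 0
  · filter_upwards [hJ.lt l x hx] with y hy _ using hy
  · exact ae_of_all _ fun y h => absurd h hx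

/-- The kernel is larger for the pair of points that lie on the same side of the hyperplane. -/
lemma ae_le_of_opposite (hJ : NiceKernel J) (l : ℝ) : ∀ᵐ p : E n × E n,
    (l < p.1 0 ∧ p.2 0 < l ∨ p.1 0 < l ∧ l < p.2 0) →
      J (p.1 - p.2) ≤ J (p.1 - reflect l p.2) := by
  filter_upwards [(measurePreserving_reflect_snd l).quasiMeasurePreserving.ae (hJ.ae_lt l),
    (measurePreserving_reflect_fst l).quasiMeasurePreserving.ae (hJ.ae_lt l)] with p h1 h2 h
  rcases h with ⟨a, b⟩ | ⟨a, b⟩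
  · have := h1 a (by simp; linarith)
    simp only [reflect_reflect] at this
    exact this.le
  · have := h2 (by simp; linarith) b
    simp only [hJ.kernel_reflect_sub_reflect, hJ.kernel_reflect_sub] at this
    exact this.le

lemma form_comp_reflect (hJ : NiceKernel J) (l : ℝ) (u v : E n → ℝ) :
    form J (fun x => u (reflect l x)) v = form J u (fun x => v (reflect l x)) := by
  have h := ((measurePreserving_reflect_fst (n := n) l).comp
    (measurePreserving_reflect_snd l)).integral_comp ((measurableEmbedding_reflect_fst l).comp
    (measurableEmbedding_reflect_snd l)) (inc J u (fun x => v (reflect l x)))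
  rw [form_eq, form_eq, ← h]
  congr 2
  ext p
  simp only [inc, Function.comp, reflect_reflect, hJ.kernel_reflect_sub_reflect]

lemma energy_comp_reflect (hJ : NiceKernel J) (l : ℝ) (u : E n → ℝ) :
    energy J (fun x => u (reflect l x)) = energy J u := by
  have h := ((measurePreserving_reflect_fst (n := n) l).comp
    (measurePreserving_reflect_snd l)).lintegral_comp_emb ((measurableEmbedding_reflect_fst l).comp
    (measurableEmbedding_reflect_snd l)) (fun p => ENNReal.ofReal (inc J u u p))
  rw [energy_eq, energy_eq, ← h]
  congr 2
  ext p
  simp only [inc, Function.comp, hJ.kernel_reflect_sub_reflect]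

end NiceKernel

/-! ### Antisymmetric functions -/

/-- To see that an integral over pairs of points is nonpositive it suffices to sum the integrand
over the four pairs obtained by reflecting each of the points, and these sums need only be
considered for points in the half space. -/
lemma integral_nonpos_of_reflect_sum (l : ℝ) {G : E n × E n → ℝ} (hG : Integrable G)
    (h : ∀ᵐ p : E n × E n, l < p.1 0 → l < p.2 0 →
      G p + G (reflect l p.1, p.2) + G (p.1, reflect l p.2) +
        G (reflect l p.1, reflect l p.2) ≤ 0) : ∫ p, G p ≤ 0 := by
  have m1 := measurePreserving_reflect_fst (n := n) l
  have m2 := measurePreserving_reflect_snd (n := n) l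
  have e1 := measurableEmbedding_reflect_fst (n := n) l
  have e2 := measurableEmbedding_reflect_snd (n := n) l
  have m3 := m1.comp m2
  have i1 : Integrable fun p : E n × E n => G (reflect l p.1, p.2) :=
    m1.integrable_comp_of_integrable hG
  have i2 : Integrable fun p : E n × E n => G (p.1, reflect l p.2) :=
    m2.integrable_comp_of_integrable hG
  have i3 : Integrable fun p : E n × E n => G (reflect l p.1, reflect l p.2) :=
    m3.integrable_comp_of_integrable hG
  have q1 := m1.integral_comp e1 G
  have q2 := m2.integral_comp e2 G
  have q3 := m3.integral_comp (e1.comp e2) G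
  have hsum : ∀ᵐ p : E n × E n, G p + G (reflect l p.1, p.2) + G (p.1, reflect l p.2) +
        G (reflect l p.1, reflect l p.2) ≤ 0 := by
    filter_upwards [h, m1.quasiMeasurePreserving.ae h, m2.quasiMeasurePreserving.ae h,
      m3.quasiMeasurePreserving.ae h, ae_fst (ae_first_ne l), ae_snd (ae_first_ne l)]
      with p a b c d e f
    simp only [reflect_reflect, reflect_apply_zero, Function.comp] at b c d
    rcases lt_or_gt_of_ne e with e | e <;> rcases lt_or_gt_of_ne f with f | f
    · have := d (by linarith) (by linarith); linarith
    · have := b (by linarith) f; linarith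
    · have := c e (by linarith); linarith
    · exact a e f
  have h0 := integral_nonpos_of_ae (μ := volume) (f := fun p : E n × E n =>
    G p + G (reflect l p.1, p.2) + G (p.1, reflect l p.2) +
        G (reflect l p.1, reflect l p.2)) hsum
  have key : ∫ p : E n × E n, (G p + G (reflect l p.1, p.2) + G (p.1, reflect l p.2) +
        G (reflect l p.1, reflect l p.2)) = (∫ p, G p) + (∫ p : E n × E n, G (reflect l p.1, p.2))
        + (∫ p : E n × E n, G (p.1, reflect l p.2)) +
        ∫ p : E n × E n, G (reflect l p.1, reflect l p.2) := by
    rw [integral_add (f := fun p : E n × E n => G p + G (reflect l p.1, p.2) +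
      G (p.1, reflect l p.2)) ((hG.add i1).add i2) i3,
      integral_add (f := fun p : E n × E n => G p + G (reflect l p.1, p.2)) (hG.add i1) i2,
      integral_add hG i1]
  simp only [Function.comp] at q3
  rw [key, q1, q2, q3] at h0
  linarith

namespace NiceKernel

variable {J : E n → ℝ}

/-- The energy estimate behind all maximum principles for antisymmetric functions: testing `W`
with the negative part of its restriction to the half space gives at most `-𝒥(v, v)`. -/
lemma integral_inc_add_nonpos (hJ : NiceKernel J) (l : ℝ) {W v : E n → ℝ}
    (hW : ∀ x, W (reflect l x) = - W x)
    (hv : ∀ᵐ x, v x = if l < x 0 then max (-W x) 0 else 0)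
    (h1 : Integrable (inc J W v)) (h2 : Integrable (inc J v v)) :
    (∫ p, inc J W v p) + ∫ p, inc J v v p ≤ 0 := by
  rw [← integral_add h1 h2]
  refine integral_nonpos_of_reflect_sum l (h1.add h2) ?_
  have hv' := ae_reflect l hv
  filter_upwards [ae_fst hv, ae_snd hv, ae_fst hv', ae_snd hv', hJ.ae_lt l] with p a b c d e h h'
  rw [if_pos h] at a
  rw [if_pos h'] at b
  rw [reflect_apply_zero, if_neg (by linarith)] at c d
  have hK := (e h h').le
  have hK' := hJ.nonneg (p.1 - reflect l p.2)
  simp only [inc, c, d, hW, hJ.kernel_reflect_sub_reflect, hJ.kernel_reflect_sub]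
  set K := J (p.1 - p.2)
  set K' := J (p.1 - reflect l p.2)
  have s1 : 0 ≤ v p.1 := a ▸ le_max_right _ _
  have s2 : 0 ≤ v p.2 := b ▸ le_max_right _ _
  have t1 : 0 ≤ W p.1 + v p.1 := by have := le_max_left (-W p.1) 0; rw [a]; linarith
  have t2 : 0 ≤ W p.2 + v p.2 := by have := le_max_left (-W p.2) 0; rw [b]; linarith
  have r1 : (W p.1 + v p.1) * v p.1 = 0 := by
    rcases max_choice (-W p.1) 0 with h | h <;> rw [a, h] <;> simp
  have r2 : (W p.2 + v p.2) * v p.2 = 0 := by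
    rcases max_choice (-W p.2) 0 with h | h <;> rw [b, h] <;> simp
  generalize v p.1 = α at *
  generalize v p.2 = β at *
  generalize W p.1 = A at *
  generalize W p.2 = B at *
  have f1 : 0 ≤ ((A + α) * β + (B + β) * α) * (K - K') :=
    mul_nonneg (by positivity) (by linarith)
  have f2 : 0 ≤ α * β * K' := by positivity
  linear_combination f1 + 2 * f2 + (K + K') * r1 + (K + K') * r2

/-- The positive part on a half space of an antisymmetric function of finite energy has finite
energy: where only one of two points lies in the half space, the two terms on the right hand side
control the kernel. -/
lemma energy_posPart_lt_top (hJ : NiceKernel J) (l : ℝ) {g v : E n → ℝ}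
    (hg : ∀ x, g (reflect l x) = - g x) (hgm : Measurable g) (hge : energy J g < ∞)
    (hv : ∀ᵐ x, v x = if l < x 0 then max (g x) 0 else 0) : energy J v < ∞ := by
  have hle : ∫⁻ p, ENNReal.ofReal (inc J v v p) ≤
      ∫⁻ p, (ENNReal.ofReal (inc J g g p) + ENNReal.ofReal (inc J g g (p.1, reflect l p.2))) := by
    refine lintegral_mono_ae ?_
    filter_upwards [ae_fst hv, ae_snd hv, hJ.ae_le_of_opposite l, ae_fst (ae_first_ne l),
      ae_snd (ae_first_ne l)] with p a b e hx hy
    rw [← ENNReal.ofReal_add (hJ.inc_self_nonneg g _) (hJ.inc_self_nonneg g _)]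
    refine ENNReal.ofReal_le_ofReal ?_
    simp only [inc, hg]
    have hK := hJ.nonneg (p.1 - p.2)
    have hK' := hJ.nonneg (p.1 - reflect l p.2)
    have sq_max : ∀ r : ℝ, max r 0 * max r 0 ≤ r * r := fun r => by
      rcases max_choice r 0 with h | h
      · rw [h]
      · rw [h, zero_mul]; exact mul_self_nonneg r
    rcases lt_or_gt_of_ne hx with hx | hx <;> rcases lt_or_gt_of_ne hy with hy | hy
    · rw [a, b, if_neg (by linarith), if_neg (by linarith)]
      simp only [sub_self, zero_mul]
      exact add_nonneg (mul_nonneg (mul_self_nonneg _) hK) (mul_nonneg (mul_self_nonneg _) hK')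
    · rw [a, b, if_neg (by linarith), if_pos (by linarith)]
      have := mul_le_mul_of_nonneg_left (e (Or.inr ⟨hx, hy⟩))
        (mul_self_nonneg (g p.1 - -g p.2))
      have h3 := mul_le_mul_of_nonneg_right (sq_max (g p.2)) hK
      nlinarith [mul_nonneg (mul_self_nonneg (g p.1)) hK, mul_nonneg (mul_self_nonneg (g p.2)) hK]
    · rw [a, b, if_pos (by linarith), if_neg (by linarith)]
      have := mul_le_mul_of_nonneg_left (e (Or.inl ⟨hx, hy⟩))
        (mul_self_nonneg (g p.1 - -g p.2))
      have h3 := mul_le_mul_of_nonneg_right (sq_max (g p.1)) hK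
      nlinarith [mul_nonneg (mul_self_nonneg (g p.1)) hK, mul_nonneg (mul_self_nonneg (g p.2)) hK]
    · rw [a, b, if_pos (by linarith), if_pos (by linarith)]
      have h1 : |max (g p.1) 0 - max (g p.2) 0| ≤ |g p.1 - g p.2| := abs_max_sub_max_le_abs _ _ _
      have h2 := mul_le_mul_of_nonneg_right (mul_self_le_mul_self (abs_nonneg _) h1) hK
      rw [abs_mul_abs_self, abs_mul_abs_self] at h2
      have := mul_nonneg (mul_self_nonneg (g p.1 - -g p.2)) hK'
      linarith
  have hm := hJ.measurable_inc hgm hgm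
  rw [lintegral_add_left (by fun_prop), (measurePreserving_reflect_snd l).lintegral_comp_emb
    (measurableEmbedding_reflect_snd l) (fun p => ENNReal.ofReal (inc J g g p))] at hle
  have hfin := (hasFiniteIntegral_iff_ofReal (ae_of_all _ (hJ.inc_self_nonneg g))).1
    ((hJ.energy_lt_top_iff hgm).1 hge).2
  rw [energy_eq]
  exact ENNReal.mul_lt_top (by simp) (hle.trans_lt (ENNReal.add_lt_top.2 ⟨hfin, hfin⟩))

/-- Functions with small support have large energy, since the kernel is not integrable. -/
lemma exists_energy_ge (hJ : NiceKernel J) (κ : ℝ) : ∃ δ : ℝ≥0∞, 0 < δ ∧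
    ∀ (A : Set (E n)) (v : E n → ℝ), MeasurableSet A → volume A ≤ δ → Measurable v →
      (∀ x, x ∉ A → v x = 0) →
        ENNReal.ofReal κ * ∫⁻ x, ENNReal.ofReal (v x * v x) ≤ energy J v := by
  have hm := hJ.measurable
  set S : ℕ → Set (E n) := fun k => {z | J z ≤ k} with hS
  have hSm : ∀ k, MeasurableSet (S k) := fun k => measurableSet_le hm measurable_const
  have hlim : Tendsto (fun k => ∫⁻ z in S k, ENNReal.ofReal (J z)) atTop (𝓝 ∞) := by
    have hmono : Monotone S := fun i j hij z (hz : J z ≤ i) =>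
      hz.trans (by exact_mod_cast hij : (i : ℝ) ≤ j)
    have hU : ⋃ k, S k = univ := by
      ext z
      simp only [mem_iUnion, mem_univ, iff_true]
      exact exists_nat_ge (J z)
    have h1 := setLIntegral_iUnion_of_directed (μ := volume) (s := S) (fun z => ENNReal.ofReal (J z))
      hmono.directed_le
    rw [hU, setLIntegral_univ, hJ.infinite] at h1
    rw [h1]
    exact tendsto_atTop_iSup fun i j hij => lintegral_mono_set (hmono hij)
  obtain ⟨k, hk⟩ := ((ENNReal.tendsto_nhds_top_iff_nnreal.1 hlim)
    (2 * κ.toNNReal + 1)).exists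
  refine ⟨((k : ℝ≥0∞) + 1)⁻¹, by simp, fun A v hA hvol hv hv0 => ?_⟩
  -- the mass of `J (x - ·)` outside the small set `A` is still large
  have hmass : ∀ x, 2 * ENNReal.ofReal κ ≤ ∫⁻ y in Aᶜ, ENNReal.ofReal (J (x - y)) := by
    intro x
    have hT : MeasurableSet {y | x - y ∈ S k} :=
      measurableSet_preimage (by fun_prop : Measurable fun y => x - y) (hSm k)
    have e1 : ∫⁻ z in S k, ENNReal.ofReal (J z) =
        ∫⁻ y in {y | x - y ∈ S k}, ENNReal.ofReal (J (x - y)) := by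
      rw [← lintegral_indicator (hSm k), ← lintegral_indicator hT,
        ← lintegral_sub_left_eq_self _ x]
      rfl
    have e2 : ∫⁻ y in {y | x - y ∈ S k}, ENNReal.ofReal (J (x - y)) ≤
        (∫⁻ y in Aᶜ, ENNReal.ofReal (J (x - y))) + ∫⁻ _ in A, (k : ℝ≥0∞) := by
      rw [← lintegral_inter_add_sdiff _ _ hA, add_comm]
      refine add_le_add (lintegral_mono_set fun y hy => hy.2) ?_
      refine (setLIntegral_mono measurable_const fun y hy => ?_).trans
        (lintegral_mono_set inter_subset_right)
      have : J (x - y) ≤ k := hy.1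
      exact (ENNReal.ofReal_le_ofReal this).trans (by simp)
    have e3 : ∫⁻ _ in A, (k : ℝ≥0∞) ≤ 1 := by
      rw [setLIntegral_const]
      calc (k : ℝ≥0∞) * volume A ≤ ((k : ℝ≥0∞) + 1) * ((k : ℝ≥0∞) + 1)⁻¹ :=
            mul_le_mul' le_self_add hvol
        _ ≤ 1 := ENNReal.mul_inv_le_one _
    have e4 : 2 * ENNReal.ofReal κ + 1 ≤
        (∫⁻ y in Aᶜ, ENNReal.ofReal (J (x - y))) + 1 := by
      refine le_trans ?_ (e2.trans (add_le_add_right e3 _))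
      rw [← e1]
      refine le_trans (le_of_eq ?_) hk.le
      simp [ENNReal.ofReal]
    exact (ENNReal.add_le_add_iff_right ENNReal.one_ne_top).1 e4
  have hcalc : ∫⁻ x, ENNReal.ofReal (v x * v x) * (2 * ENNReal.ofReal κ) ≤
      ∫⁻ p, ENNReal.ofReal (inc J v v p) := by
    rw [Measure.volume_eq_prod, lintegral_prod _
      (hJ.measurable_inc hv hv).ennreal_ofReal.aemeasurable]
    refine lintegral_mono fun x => ?_
    by_cases hx : x ∈ A
    · calc ENNReal.ofReal (v x * v x) * (2 * ENNReal.ofReal κ)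
          ≤ ENNReal.ofReal (v x * v x) * ∫⁻ y in Aᶜ, ENNReal.ofReal (J (x - y)) := by
            gcongr; exact hmass x
        _ = ∫⁻ y in Aᶜ, ENNReal.ofReal (v x * v x) * ENNReal.ofReal (J (x - y)) := by
            rw [lintegral_const_mul _ (by fun_prop)]
        _ = ∫⁻ y in Aᶜ, ENNReal.ofReal (inc J v v (x, y)) := by
            refine setLIntegral_congr_fun hA.compl fun y hy => ?_
            simp only [inc, hv0 y hy, sub_zero]
            rw [ENNReal.ofReal_mul (mul_self_nonneg _)]
        _ ≤ _ := setLIntegral_le_lintegral _ _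
    · simp [hv0 x hx]
  rw [lintegral_mul_const _ (by fun_prop)] at hcalc
  rw [energy_eq]
  calc ENNReal.ofReal κ * ∫⁻ x, ENNReal.ofReal (v x * v x)
      = (1 / 2) * ((∫⁻ x, ENNReal.ofReal (v x * v x)) * (2 * ENNReal.ofReal κ)) := by
        rw [mul_comm, mul_left_comm (∫⁻ x, _) 2, ← mul_assoc (1 / 2 : ℝ≥0∞)]
        rw [ENNReal.div_mul_cancel (by simp) (by simp), one_mul]
    _ ≤ _ := by gcongr

end NiceKernel

/-! ### Convolutions and the kernel away from the origin -/

lemma measurePreserving_sub_pair :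
    MeasurePreserving (fun p : E n × E n => (p.1 - p.2, p.2)) volume volume :=
  measurePreserving_sub_prod volume volume

lemma integrable_mul_kernel_snd {φ k : E n → ℝ} (hφ : Integrable φ) (hk : Integrable k) :
    Integrable fun p : E n × E n => φ p.2 * k (p.1 - p.2) := by
  have h : Integrable fun p : E n × E n => k p.1 * φ p.2 := hk.mul_prod hφ
  simpa [Function.comp_def, mul_comm] using
    measurePreserving_sub_pair.integrable_comp_of_integrable h

lemma integrable_mul_kernel_fst {φ k : E n → ℝ} (hφ : Integrable φ) (hk : Integrable k)
    (hke : ∀ z, k (-z) = k z) :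
    Integrable fun p : E n × E n => φ p.1 * k (p.1 - p.2) := by
  have h := (integrable_mul_kernel_snd hφ hk).swap
  refine h.congr (ae_of_all _ fun p => ?_)
  simp only [Function.comp, Prod.fst_swap, Prod.snd_swap]
  rw [← hke (p.1 - p.2), neg_sub]

/-- The convolution of a bounded and an integrable function is continuous. -/
lemma continuous_integral_mul_sub {ψ k : E n → ℝ} {C : ℝ} (hψ : Measurable ψ)
    (hC : ∀ x, |ψ x| ≤ C) (hk : Integrable k) :
    Continuous fun x => ∫ y, ψ y * k (x - y) := by
  have hi : ∀ x, Integrable fun y => ψ y * k (x - y) := fun x =>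
    (hk.comp_sub_left x).bdd_mul hψ.aestronglyMeasurable (c := C) (ae_of_all _ hC)
  rw [continuous_iff_continuousAt]
  intro x₀
  have h := tendsto_lintegral_enorm_comp_sub (G := fun x y : E n => x - y)
    (by fun_prop) (fun x => Measure.measurePreserving_sub_left volume x) hk x₀
  have h2 : Tendsto (fun x => ENNReal.ofReal C * ∫⁻ y, ‖k (x - y) - k (x₀ - y)‖ₑ) (𝓝 x₀) (𝓝 0) := by
    simpa using ENNReal.Tendsto.const_mul h (Or.inr ENNReal.ofReal_ne_top)
  rw [ContinuousAt, tendsto_iff_edist_tendsto_0]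
  refine tendsto_of_tendsto_of_tendsto_of_le_of_le tendsto_const_nhds h2 (fun _ => zero_le)
    fun x => ?_
  simp only
  rw [edist_eq_enorm_sub, ← integral_sub (hi x) (hi x₀),
    ← lintegral_const_mul' _ _ ENNReal.ofReal_ne_top]
  refine (enorm_integral_le_lintegral_enorm _).trans (lintegral_mono fun y => ?_)
  rw [← mul_sub, enorm_mul]
  gcongr
  rw [Real.enorm_eq_ofReal_abs]
  exact ENNReal.ofReal_le_ofReal (hC y)

/-- The part of the kernel away from the origin. -/
noncomputable def farKernel (J : E n → ℝ) (r : ℝ) : E n → ℝ :=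
  {z | r ≤ ‖z‖}.indicator J

namespace NiceKernel

variable {J : E n → ℝ}

lemma farKernel_of_le {r : ℝ} {z : E n} (h : r ≤ ‖z‖) : farKernel J r z = J z :=
  indicator_of_mem (s := {z | r ≤ ‖z‖}) h J

lemma farKernel_nonneg (hJ : NiceKernel J) (r : ℝ) (z : E n) : 0 ≤ farKernel J r z :=
  indicator_nonneg (fun z _ => hJ.nonneg z) z

lemma farKernel_even (hJ : NiceKernel J) (r : ℝ) (z : E n) :
    farKernel J r (-z) = farKernel J r z := by
  simp only [farKernel, indicator, mem_ofPred_eq, norm_neg, hJ.even]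

lemma integrable_farKernel (hJ : NiceKernel J) {r : ℝ} (hr : 0 < r) :
    Integrable (farKernel J r) := by
  have hs : MeasurableSet {z : E n | r ≤ ‖z‖} := measurableSet_le measurable_const measurable_norm
  refine (hJ.levy.const_mul (min 1 (r ^ 2))⁻¹).mono'
    (hJ.measurable.indicator hs).aestronglyMeasurable (ae_of_all _ fun z => ?_)
  have h0 : 0 < min 1 (r ^ 2) := lt_min one_pos (by positivity)
  by_cases hz : r ≤ ‖z‖
  · rw [farKernel_of_le hz, Real.norm_of_nonneg (hJ.nonneg z), ← mul_assoc]
    refine le_mul_of_one_le_left (hJ.nonneg z) ?_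
    rw [inv_mul_eq_div, one_le_div h0]
    exact min_le_min_left _ (by gcongr)
  · rw [farKernel, indicator_of_notMem (s := {z | r ≤ ‖z‖}) hz, norm_zero]
    have := hJ.nonneg z
    positivity

end NiceKernel

/-! ### A bump function -/

/-- A truncated paraboloid. It is semiconvex, which is all that is needed to bound the operator
from above on it. -/
noncomputable def bump (x₀ : E n) (r : ℝ) (x : E n) : ℝ := max (r ^ 2 - ‖x - x₀‖ ^ 2) 0

lemma continuous_bump (x₀ : E n) (r : ℝ) : Continuous (bump x₀ r) := by
  unfold bump; fun_prop

lemma bump_nonneg (x₀ : E n) (r : ℝ) (x : E n) : 0 ≤ bump x₀ r x :=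
  le_max_right _ _

lemma bump_le (x₀ : E n) (r : ℝ) (x : E n) : bump x₀ r x ≤ r ^ 2 :=
  max_le (by nlinarith [sq_nonneg ‖x - x₀‖]) (sq_nonneg r)

lemma bump_eq_zero {x₀ : E n} {r : ℝ} {x : E n} (hr : 0 ≤ r)
    (h : x ∉ Metric.ball x₀ r) : bump x₀ r x = 0 := by
  rw [Metric.mem_ball, dist_eq_norm, not_lt] at h
  exact max_eq_right (by nlinarith)

lemma bump_second_difference (x₀ : E n) (r : ℝ) (y z : E n) :
    2 * bump x₀ r y - bump x₀ r (y - z) - bump x₀ r (y + z) ≤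
      2 * ((1 + r ^ 2) * min 1 (‖z‖ ^ 2)) := by
  have h1 := bump_nonneg x₀ r (y - z)
  have h2 := bump_nonneg x₀ r (y + z)
  have h3 := bump_le x₀ r y
  have hA : 2 * bump x₀ r y - bump x₀ r (y - z) - bump x₀ r (y + z) ≤ 2 * ‖z‖ ^ 2 := by
    rcases max_choice (r ^ 2 - ‖y - x₀‖ ^ 2) 0 with h | h
    · have k1 : r ^ 2 - ‖y - z - x₀‖ ^ 2 ≤ bump x₀ r (y - z) := le_max_left _ _
      have k2 : r ^ 2 - ‖y + z - x₀‖ ^ 2 ≤ bump x₀ r (y + z) := le_max_left _ _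
      have par := parallelogram_law_with_norm ℝ (y - x₀) z
      rw [show y - x₀ + z = y + z - x₀ by abel, show y - x₀ - z = y - z - x₀ by abel] at par
      have : bump x₀ r y = r ^ 2 - ‖y - x₀‖ ^ 2 := h
      nlinarith
    · have : bump x₀ r y = 0 := h
      nlinarith [sq_nonneg ‖z‖]
  rcases min_choice 1 (‖z‖ ^ 2) with h | h <;> rw [h] <;> nlinarith [sq_nonneg ‖z‖, sq_nonneg r,
    mul_nonneg (sq_nonneg r) (sq_nonneg ‖z‖)]

lemma bump_sub_sq_le (x₀ : E n) {r : ℝ} (hr : 0 ≤ r) (x y : E n) :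
    (bump x₀ r x - bump x₀ r y) * (bump x₀ r x - bump x₀ r y) ≤
      (r ^ 4 + 4 * r ^ 2) * min 1 (‖x - y‖ ^ 2) := by
  have e : ∀ x, bump x₀ r x = r ^ 2 - (min ‖x - x₀‖ r) ^ 2 := by
    intro x
    simp only [bump]
    rcases le_total ‖x - x₀‖ r with h | h
    · rw [min_eq_left h, max_eq_left (by nlinarith [norm_nonneg (x - x₀)])]
    · rw [min_eq_right h, max_eq_right (by nlinarith [norm_nonneg (x - x₀)]), sub_self]
  have h1 : |bump x₀ r x - bump x₀ r y| ≤ r ^ 2 :=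
    abs_sub_le_of_nonneg_of_le (bump_nonneg _ _ _) (bump_le _ _ _) (bump_nonneg _ _ _)
      (bump_le _ _ _)
  have h2 : |bump x₀ r x - bump x₀ r y| ≤ 2 * r * ‖x - y‖ := by
    rw [e x, e y, show r ^ 2 - (min ‖x - x₀‖ r) ^ 2 - (r ^ 2 - (min ‖y - x₀‖ r) ^ 2) =
      (min ‖y - x₀‖ r + min ‖x - x₀‖ r) * (min ‖y - x₀‖ r - min ‖x - x₀‖ r) by ring, abs_mul]
    have k1 : |min ‖y - x₀‖ r - min ‖x - x₀‖ r| ≤ ‖x - y‖ := by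
      refine (abs_min_sub_min_le_max _ _ _ _).trans ?_
      rw [sub_self, abs_zero, max_eq_left (abs_nonneg _), norm_sub_rev x y]
      have := abs_norm_sub_norm_le (y - x₀) (x - x₀)
      rwa [sub_sub_sub_cancel_right] at this
    have n1 : 0 ≤ min ‖x - x₀‖ r := le_min (norm_nonneg _) hr
    have n2 : 0 ≤ min ‖y - x₀‖ r := le_min (norm_nonneg _) hr
    rw [abs_of_nonneg (by positivity)]
    refine mul_le_mul ?_ k1 (abs_nonneg _) (by positivity)
    linarith [min_le_right ‖x - x₀‖ r, min_le_right ‖y - x₀‖ r]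
  rw [← abs_mul_abs_self]
  have h0 := abs_nonneg (bump x₀ r x - bump x₀ r y)
  have s1 := mul_self_le_mul_self h0 h1
  have s2 := mul_self_le_mul_self h0 h2
  rcases min_choice 1 (‖x - y‖ ^ 2) with h | h <;> rw [h]
  · nlinarith [sq_nonneg r]
  · nlinarith [mul_nonneg (sq_nonneg (r ^ 2)) (sq_nonneg ‖x - y‖)]

namespace NiceKernel

variable {J : E n → ℝ}

lemma energy_bump_lt_top (hJ : NiceKernel J) (x₀ : E n) {r : ℝ} (hr : 0 ≤ r) :
    energy J (bump x₀ r) < ∞ := by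
  have hm : Measurable (bump x₀ r) := (continuous_bump x₀ r).measurable
  rw [hJ.energy_lt_top_iff hm]
  set χ : E n → ℝ := (Metric.ball x₀ r).indicator 1
  have hχ : Integrable χ :=
    (integrable_indicator_iff measurableSet_ball).2
      (integrableOn_const (by simpa using measure_ball_lt_top.ne))
  have hk := hJ.levy.const_mul (r ^ 4 + 4 * r ^ 2)
  have hke : ∀ z : E n, (r ^ 4 + 4 * r ^ 2) * (min 1 (‖-z‖ ^ 2) * J (-z)) =
      (r ^ 4 + 4 * r ^ 2) * (min 1 (‖z‖ ^ 2) * J z) := fun z => by rw [norm_neg, hJ.even]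
  refine ((integrable_mul_kernel_fst hχ hk hke).add (integrable_mul_kernel_snd hχ hk)).mono'
    (hJ.measurable_inc hm hm).aestronglyMeasurable (ae_of_all _ fun p => ?_)
  rw [Real.norm_of_nonneg (hJ.inc_self_nonneg _ p)]
  have hb := mul_le_mul_of_nonneg_right (bump_sub_sq_le x₀ hr p.1 p.2) (hJ.nonneg (p.1 - p.2))
  have hχ0 : ∀ x, 0 ≤ χ x := fun x => indicator_nonneg (fun _ _ => zero_le_one) x
  have hK : 0 ≤ (r ^ 4 + 4 * r ^ 2) * (min 1 (‖p.1 - p.2‖ ^ 2) * J (p.1 - p.2)) := by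
    have := hJ.nonneg (p.1 - p.2)
    positivity
  simp only [Pi.add_apply, ← add_mul]
  by_cases h : p.1 ∈ Metric.ball x₀ r ∨ p.2 ∈ Metric.ball x₀ r
  · have h1 : 1 ≤ χ p.1 + χ p.2 := by
      rcases h with h | h
      · have : χ p.1 = 1 := indicator_of_mem h 1
        linarith [hχ0 p.2]
      · have : χ p.2 = 1 := indicator_of_mem h 1
        linarith [hχ0 p.1]
    refine le_trans ?_ (le_mul_of_one_le_left hK h1)
    rw [← mul_assoc]
    exact hb
  · push Not at h
    simp only [inc, bump_eq_zero hr h.1, bump_eq_zero hr h.2, sub_self, zero_mul]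
    exact mul_nonneg (add_nonneg (hχ0 _) (hχ0 _)) hK

/-- Weak form of the bound `I f ≤ C` for the bump `f`. In the variables `z = x - y` and `y`, for
each fixed `z` the form becomes an integral of second differences of `f`. -/
lemma form_bump_le (hJ : NiceKernel J) (x₀ : E n) {r : ℝ} (hr : 0 ≤ r) {φ : E n → ℝ}
    (hφm : Measurable φ) (hφ0 : ∀ x, 0 ≤ φ x) (hφi : Integrable φ) (hφe : energy J φ < ∞) :
    form J (bump x₀ r) φ ≤
      ((1 + r ^ 2) * ∫ z, min 1 (‖z‖ ^ 2) * J z) * ∫ x, φ x := by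
  set f := bump x₀ r with hf
  have hfm : Measurable f := (continuous_bump x₀ r).measurable
  have hfb : ∀ x, ‖f x‖ ≤ r ^ 2 := fun x => by
    rw [Real.norm_of_nonneg (bump_nonneg _ _ _)]; exact bump_le _ _ _
  have hi := hJ.integrable_inc hfm hφm (hJ.energy_bump_lt_top x₀ hr) hφe
  have mp : MeasurePreserving (fun p : E n × E n => (p.1 + p.2, p.2)) volume volume :=
    measurePreserving_add_prod volume volume
  have emb : MeasurableEmbedding (fun p : E n × E n => (p.1 + p.2, p.2)) := by
    have : MeasurableEquiv.symm (⟨⟨fun p : E n × E n => (p.1 - p.2, p.2),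
      fun p => (p.1 + p.2, p.2), fun p => by simp, fun p => by simp⟩, by
        change Measurable fun p : E n × E n => (p.1 - p.2, p.2); fun_prop, by
        change Measurable fun p : E n × E n => (p.1 + p.2, p.2); fun_prop⟩ :
          (E n × E n) ≃ᵐ (E n × E n)) = fun p : E n × E n => (p.1 + p.2, p.2) := rfl
    rw [← this]
    exact MeasurableEquiv.measurableEmbedding _
  have hi' : Integrable fun p : E n × E n => inc J f φ (p.1 + p.2, p.2) :=
    mp.integrable_comp_of_integrable hi
  have e1 : ∫ p, inc J f φ p = ∫ z, ∫ y, inc J f φ (z + y, y) := by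
    rw [← mp.integral_comp emb]
    exact integral_prod _ hi'
  have i1 : ∀ g : E n → ℝ, Measurable g → (∀ y, ‖g y‖ ≤ 2 * r ^ 2) →
      Integrable fun y => g y * φ y := fun g hg hb =>
    hφi.bdd_mul hg.aestronglyMeasurable (ae_of_all _ hb)
  have hfb2 : ∀ x y, ‖f x - f y‖ ≤ 2 * r ^ 2 := fun x y => by
    have := norm_sub_le (f x) (f y); linarith [hfb x, hfb y]
  have e2 : ∀ z, ∫ y, inc J f φ (z + y, y) ≤
      2 * ((1 + r ^ 2) * ∫ x, φ x) * (min 1 (‖z‖ ^ 2) * J z) := by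
    intro z
    have j1 : Integrable fun y => (f y - f (y - z)) * φ y :=
      i1 _ (by fun_prop) (fun y => hfb2 _ _)
    have j2 : Integrable fun y => (f (y + z) - f y) * φ y :=
      i1 _ (by fun_prop) (fun y => hfb2 _ _)
    have j1' : Integrable fun y => (f (y + z) - f y) * φ (y + z) := by
      simpa using j1.comp_add_right z
    have s1 : ∫ y, (f (y + z) - f y) * φ (y + z) = ∫ y, (f y - f (y - z)) * φ y := by
      rw [← integral_add_right_eq_self (fun y => (f y - f (y - z)) * φ y) z]
      simp
    have s2 : ∫ y, inc J f φ (z + y, y) =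
        (∫ y, (2 * f y - f (y - z) - f (y + z)) * φ y) * J z := by
      have : ∫ y, (2 * f y - f (y - z) - f (y + z)) * φ y =
          (∫ y, (f (y + z) - f y) * φ (y + z)) - ∫ y, (f (y + z) - f y) * φ y := by
        rw [s1, ← integral_sub j1 j2]
        congr 1; ext y; ring
      rw [this, ← integral_sub j1' j2, ← integral_mul_const]
      congr 1; ext y
      simp only [inc, add_sub_cancel_right]
      rw [add_comm z y]
      ring
    have s3 : ∫ y, (2 * f y - f (y - z) - f (y + z)) * φ y ≤
        ∫ y, 2 * ((1 + r ^ 2) * min 1 (‖z‖ ^ 2)) * φ y := by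
      refine integral_mono ?_ (hφi.const_mul _) fun y =>
        mul_le_mul_of_nonneg_right (bump_second_difference x₀ r y z) (hφ0 y)
      refine (j1.sub j2).congr (ae_of_all _ fun y => ?_)
      simp only [Pi.sub_apply]; ring
    rw [integral_const_mul] at s3
    rw [s2]
    refine (mul_le_mul_of_nonneg_right s3 (hJ.nonneg z)).trans (le_of_eq (by ring))
  have e3 : ∫ p, inc J f φ p ≤
      ∫ z, 2 * ((1 + r ^ 2) * ∫ x, φ x) * (min 1 (‖z‖ ^ 2) * J z) := by
    rw [e1]
    exact integral_mono hi'.integral_prod_left (hJ.levy.const_mul _) e2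
  rw [integral_const_mul] at e3
  rw [form_eq]
  linarith

/-! ### Separated supports -/

/-- If the supports are separated, then the form is a double integral against the integrable part
of the kernel, and no finiteness of the energy of `ψ` is needed. -/
lemma inc_of_separated (hJ : NiceKernel J) {x₀ : E n} {r C : ℝ} (hr : 0 < r) {ψ v : E n → ℝ}
    (hψm : Measurable ψ) (hψC : ∀ x, |ψ x| ≤ C) (hψ0 : ∀ x ∈ Metric.ball x₀ (2 * r), ψ x = 0)
    (hvi : Integrable v) (hv0 : ∀ x, x ∉ Metric.ball x₀ r → v x = 0) :
    Integrable (inc J ψ v) ∧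
      ∫ p, inc J ψ v p = -2 * ∫ x, v x * ∫ y, ψ y * farKernel J r (x - y) := by
  set k := farKernel J r with hk
  have hki := hJ.integrable_farKernel hr
  have hke := hJ.farKernel_even r
  -- `ψ` and `v` are never nonzero at the same point
  have hpt : ∀ p, inc J ψ v p =
      -(ψ p.1 * (v p.2 * k (p.1 - p.2))) - ψ p.2 * (v p.1 * k (p.1 - p.2)) := by
    have hfar : ∀ x y, v x ≠ 0 → ψ y ≠ 0 → r ≤ ‖x - y‖ := by
      intro x y hx hy
      have h1 : x ∈ Metric.ball x₀ r := by by_contra h; exact hx (hv0 x h)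
      have h2 : y ∉ Metric.ball x₀ (2 * r) := fun h => hy (hψ0 y h)
      rw [Metric.mem_ball] at h1 h2
      rw [← dist_eq_norm]
      linarith [dist_triangle_left y x₀ x]
    have hz : ∀ x, v x ≠ 0 → ψ x = 0 := by
      intro x hx
      by_contra h
      have := hfar x x hx h
      simp at this; linarith
    intro p
    simp only [inc]
    by_cases h1 : v p.1 = 0 <;> by_cases h2 : v p.2 = 0
    · simp [h1, h2]
    · rw [h1, hz _ h2]
      by_cases h3 : ψ p.1 = 0
      · simp [h3]
      · rw [hk, farKernel_of_le (by rw [norm_sub_rev]; exact hfar _ _ h2 h3)]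
        ring
    · rw [h2, hz _ h1]
      by_cases h3 : ψ p.2 = 0
      · simp [h3]
      · rw [hk, farKernel_of_le (hfar _ _ h1 h3)]
        ring
    · simp [hz _ h1, hz _ h2]
  have j1 : Integrable fun p : E n × E n => ψ p.1 * (v p.2 * k (p.1 - p.2)) :=
    (integrable_mul_kernel_snd hvi hki).bdd_mul
      (hψm.comp measurable_fst).aestronglyMeasurable (ae_of_all _ fun p => hψC p.1)
  have j2 : Integrable fun p : E n × E n => ψ p.2 * (v p.1 * k (p.1 - p.2)) :=
    (integrable_mul_kernel_fst hvi hki hke).bdd_mul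
      (hψm.comp measurable_snd).aestronglyMeasurable (ae_of_all _ fun p => hψC p.2)
  have hfun : inc J ψ v = fun p : E n × E n =>
      -(ψ p.1 * (v p.2 * k (p.1 - p.2))) - ψ p.2 * (v p.1 * k (p.1 - p.2)) := funext hpt
  have s1 : ∫ p : E n × E n, ψ p.1 * (v p.2 * k (p.1 - p.2)) =
      ∫ p : E n × E n, ψ p.2 * (v p.1 * k (p.1 - p.2)) := by
    rw [Measure.volume_eq_prod, ← integral_prod_swap]
    congr 1; ext p
    simp only [Prod.fst_swap, Prod.snd_swap]
    rw [hk, ← hke, neg_sub]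
  have s2 : ∫ p : E n × E n, ψ p.2 * (v p.1 * k (p.1 - p.2)) =
      ∫ x, v x * ∫ y, ψ y * k (x - y) := by
    refine (integral_prod _ j2).trans ?_
    congr 1; ext x
    rw [← integral_const_mul]
    congr 1; ext y; ring
  rw [hfun]
  refine ⟨j1.neg.sub j2, ?_⟩
  have s3 := integral_sub j1.neg j2
  simp only [Pi.neg_apply] at s3
  rw [s3, integral_neg, s1, s2]
  ring

end NiceKernel

/-! ### The strong maximum principle for antisymmetric supersolutions -/

/-- Admissible nonnegative test functions with support in `U`. -/
structure IsTest (J : E n → ℝ) (U : Set (E n)) (φ : E n → ℝ) : Prop where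
  measurable : Measurable φ
  nonneg : ∀ x, 0 ≤ φ x
  integrable : Integrable φ
  energy_lt_top : energy J φ < ∞
  eq_zero : ∀ x, x ∉ U → φ x = 0

/-- `w` is a bounded function of finite energy, antisymmetric with respect to `{x₁ = l}`, and
satisfies `I w ≥ - L |w|` in `U` in the weak sense. -/
structure IsAntisymmSuper (J : E n → ℝ) (l : ℝ) (U : Set (E n)) (L M : ℝ) (w : E n → ℝ) :
    Prop where
  measurable : Measurable w
  antisymm : ∀ x, w (reflect l x) = - w x
  bound : ∀ x, |w x| ≤ M
  energy_lt_top : energy J w < ∞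
  super : ∀ φ, IsTest J U φ → -L * ∫ x, |w x| * φ x ≤ form J w φ

lemma exists_measure_ball_le (x₀ : E n) {ε : ℝ≥0∞} (hε : 0 < ε) :
    ∀ᶠ r in 𝓝[>] (0 : ℝ), volume (Metric.ball x₀ (2 * r)) ≤ ε := by
  have h : Tendsto (fun r : ℝ => volume (Metric.ball x₀ (2 * r))) (𝓝[>] 0) (𝓝 0) := by
    have e : ∀ r : ℝ, volume (Metric.ball x₀ (2 * r)) =
        ENNReal.ofReal ((2 * r) ^ (Module.finrank ℝ (E n))) *
          volume (Metric.ball (0 : E n) 1) ∨ r ≤ 0 := fun r => by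
      rcases le_or_gt r 0 with h | h
      · exact Or.inr h
      · exact Or.inl (Measure.addHaar_ball_of_pos volume x₀ (by positivity))
    have h1 : Tendsto (fun r : ℝ => ENNReal.ofReal ((2 * r) ^ (Module.finrank ℝ (E n))) *
          volume (Metric.ball (0 : E n) 1)) (𝓝[>] 0) (𝓝 0) := by
      have h2 : Tendsto (fun r : ℝ => (2 * r) ^ (Module.finrank ℝ (E n))) (𝓝[>] 0) (𝓝 0) := by
        have : Continuous fun r : ℝ => (2 * r) ^ (Module.finrank ℝ (E n)) := by fun_prop
        have h3 := this.tendsto 0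
        rw [mul_zero, zero_pow (by simp)] at h3
        exact h3.mono_left nhdsWithin_le_nhds
      have h4 := ENNReal.Tendsto.mul_const (b := volume (Metric.ball (0 : E n) 1))
        (ENNReal.tendsto_ofReal h2) (Or.inr measure_ball_lt_top.ne)
      simpa using h4
    refine h1.congr' ?_
    filter_upwards [self_mem_nhdsWithin] with r hr
    exact ((e r).resolve_right (not_le.2 hr)).symm
  exact h.eventually_le_const hε

namespace NiceKernel

variable {J : E n → ℝ}

/-- A set of positive measure in the half space acts on a separated ball with a kernel that is
bounded from below, because its mirror image acts less strongly. -/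
lemma exists_pos_le_potential (hJ : NiceKernel J) {l : ℝ} {x₀ : E n} {r : ℝ} (hr : 0 < r)
    (hB : Metric.ball x₀ (3 * r) ⊆ {x | l < x 0}) {A : Set (E n)} (hA : MeasurableSet A)
    (hAH : A ⊆ {x | l < x 0}) (hAB : Disjoint A (Metric.ball x₀ (2 * r))) (hA0 : volume A ≠ 0) :
    ∃ θ : ℝ, 0 < θ ∧ ∀ x ∈ Metric.ball x₀ r,
      θ ≤ ∫ y, (A.indicator 1 y - A.indicator 1 (reflect l y)) * farKernel J r (x - y) := by
  set k := farKernel J r with hk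
  have hki : Integrable k := hJ.integrable_farKernel hr
  set χ : E n → ℝ := A.indicator 1 with hχ
  have hχm : Measurable χ := measurable_one.indicator hA
  have hχ0 : ∀ x, 0 ≤ χ x := fun x => indicator_nonneg (fun _ _ => zero_le_one) x
  have hχ1 : ∀ x, χ x ≤ 1 := fun x => indicator_le_self' (fun _ _ => zero_le_one) x
  have hcont : Continuous fun x => ∫ y, (χ y - χ (reflect l y)) * k (x - y) :=
    continuous_integral_mul_sub (C := 1) (hχm.sub (hχm.comp (measurable_reflect l)))
      (fun y => abs_sub_le_of_nonneg_of_le (hχ0 _) (hχ1 _) (hχ0 _) (hχ1 _)) hki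
  have hpos : ∀ x ∈ Metric.closedBall x₀ r,
      0 < ∫ y, (χ y - χ (reflect l y)) * k (x - y) := by
    intro x hx
    have hxH : l < x 0 := hB (Metric.closedBall_subset_ball (by linarith) hx)
    have i1 : Integrable fun y => χ y * k (x - y) :=
      (hki.comp_sub_left x).bdd_mul hχm.aestronglyMeasurable (c := 1)
        (ae_of_all _ fun y => by rw [Real.norm_of_nonneg (hχ0 y)]; exact hχ1 y)
    have i2 : Integrable fun y => χ (reflect l y) * k (x - y) :=
      (hki.comp_sub_left x).bdd_mul (hχm.comp (measurable_reflect l)).aestronglyMeasurable (c := 1)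
        (ae_of_all _ fun y => by
          change ‖χ (reflect l y)‖ ≤ 1
          rw [Real.norm_of_nonneg (hχ0 _)]; exact hχ1 _)
    have i3 : Integrable fun y => χ y * k (x - reflect l y) := by
      have := (measurePreserving_reflect l).integrable_comp_of_integrable i2
      simpa [Function.comp_def] using this
    have e : ∫ y, (χ y - χ (reflect l y)) * k (x - y) =
        ∫ y, χ y * (k (x - y) - k (x - reflect l y)) := by
      have e1 : ∫ y, χ (reflect l y) * k (x - y) = ∫ y, χ y * k (x - reflect l y) := by
        rw [← integral_comp_reflect l]
        simp
      simp only [sub_mul, mul_sub]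
      rw [integral_sub i1 i2, integral_sub i1 i3, e1]
    rw [e]
    -- on `A` the truncation of the kernel is not felt
    have hfar : ∀ y ∈ A, k (x - y) = J (x - y) ∧ k (x - reflect l y) = J (x - reflect l y) := by
      intro y hy
      have hyB := disjoint_left.1 hAB hy
      have hyB' : reflect l y ∉ Metric.ball x₀ (3 * r) := fun h => by
        have h1 : l < reflect l y 0 := hB h
        have h2 : l < y 0 := hAH hy
        rw [reflect_apply_zero] at h1
        linarith
      rw [Metric.mem_ball, not_lt] at hyB hyB'
      rw [Metric.mem_closedBall] at hx
      constructor <;> refine farKernel_of_le ?_ <;> rw [← dist_eq_norm]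
      · linarith [dist_triangle_left y x₀ x]
      · linarith [dist_triangle_left (reflect l y) x₀ x]
    have hlt : ∀ᵐ y, y ∈ A → 0 < χ y * (k (x - y) - k (x - reflect l y)) := by
      filter_upwards [hJ.lt l x hxH] with y hy hyA
      have : χ y = 1 := indicator_of_mem hyA 1
      rw [this, (hfar y hyA).1, (hfar y hyA).2, one_mul]
      exact sub_pos.2 (hy (hAH hyA))
    have hnn : 0 ≤ᵐ[volume] fun y => χ y * (k (x - y) - k (x - reflect l y)) := by
      filter_upwards [hlt] with y hy
      by_cases hyA : y ∈ A
      · exact (hy hyA).le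
      · have : χ y = 0 := indicator_of_notMem hyA 1
        simp [this]
    rw [integral_pos_iff_support_of_nonneg_ae hnn 
      ((i1.sub i3).congr (ae_of_all _ fun y => (mul_sub _ _ _).symm))]
    refine lt_of_lt_of_le (pos_iff_ne_zero.2 hA0) (measure_mono_ae ?_)
    filter_upwards [hlt] with y hy hyA
    exact (hy hyA).ne'
  obtain ⟨z, hz, hmin⟩ := (isCompact_closedBall x₀ r).exists_isMinOn
    ⟨x₀, Metric.mem_closedBall_self hr.le⟩ hcont.continuousOn
  exact ⟨_, hpos z hz, fun x hx => hmin (Metric.ball_subset_closedBall hx)⟩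

set_option maxHeartbeats 1000000 in
/-- The strong maximum principle. The supersolution `w` is compared with a small multiple of the
antisymmetrization of `f + a 1_A`, where `f` is a bump at `x₀`, `w` is bounded away from zero on
the set `A`, and `a` is so large that the contribution of `A` outweighs that of `f`. -/
theorem strong_maximum_principle (hJ : NiceKernel J) {l L M : ℝ} (hL : 0 ≤ L) {U : Set (E n)}
    (hU : IsOpen U) (hUH : U ⊆ {x | l < x 0}) {w : E n → ℝ} (hw : IsAntisymmSuper J l U L M w)
    (hw0 : ∀ᵐ x, l < x 0 → 0 ≤ w x) (hne : ¬ ∀ᵐ x, l < x 0 → w x = 0) {x₀ : E n} (hx₀ : x₀ ∈ U) :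
    ∃ r > 0, ∃ c > 0, ∀ᵐ x, x ∈ Metric.ball x₀ r → c ≤ w x := by
  have hwm := hw.measurable
  have hHm : MeasurableSet {x : E n | l < x 0} := measurableSet_lt measurable_const (by fun_prop)
  -- a level set of positive measure
  obtain ⟨m, hm, hA₀⟩ : ∃ m : ℝ, 0 < m ∧ volume {x : E n | l < x 0 ∧ m ≤ w x} ≠ 0 := by
    by_contra! hcon
    apply hne
    have h1 : ∀ᵐ x : E n, ∀ k : ℕ, ¬ (l < x 0 ∧ 1 / ((k : ℝ) + 1) ≤ w x) := by
      rw [ae_all_iff]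
      intro k
      rw [ae_iff]
      simpa using hcon (1 / ((k : ℝ) + 1)) (by positivity)
    filter_upwards [h1, hw0] with x h2 h3 h4
    refine le_antisymm ?_ (h3 h4)
    by_contra! h5
    obtain ⟨k, hk⟩ := exists_nat_one_div_lt h5
    exact h2 k ⟨h4, hk.le⟩
  set A₀ := {x : E n | l < x 0 ∧ m ≤ w x} with hA₀def
  have hA₀m : MeasurableSet A₀ := hHm.inter (measurableSet_le measurable_const hwm)
  obtain ⟨δ, hδ, hlow⟩ := hJ.exists_energy_ge 1
  obtain ⟨ε', hε'0, hε'⟩ := exists_between (pos_iff_ne_zero.2 hA₀)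
  obtain ⟨ρ, hρ, hρU⟩ := Metric.isOpen_iff.1 hU x₀ hx₀
  obtain ⟨r, ⟨⟨hr1, hr2⟩, hr3⟩, hr⟩ := (((exists_measure_ball_le x₀ hδ).and
    (exists_measure_ball_le x₀ hε'0)).and (nhdsWithin_le_nhds
      (Iio_mem_nhds (show (0 : ℝ) < ρ / 3 by positivity)))).and self_mem_nhdsWithin |>.exists
  replace hr : 0 < r := hr
  replace hr3 : r < ρ / 3 := hr3
  have hBU : Metric.ball x₀ (3 * r) ⊆ U :=
    (Metric.ball_subset_ball (by linarith)).trans hρU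
  have hBH : Metric.ball x₀ (3 * r) ⊆ {x | l < x 0} := hBU.trans hUH
  set B := Metric.ball x₀ r with hBdef
  have hBm : MeasurableSet B := measurableSet_ball
  have hBB : B ⊆ Metric.ball x₀ (2 * r) := Metric.ball_subset_ball (by linarith)
  have hBB3 : Metric.ball x₀ (2 * r) ⊆ Metric.ball x₀ (3 * r) :=
    Metric.ball_subset_ball (by linarith)
  set A := A₀ \ Metric.ball x₀ (2 * r) with hAdef
  have hAm : MeasurableSet A := hA₀m.diff measurableSet_ball
  have hAH : A ⊆ {x | l < x 0} := fun x hx => hx.1.1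
  have hAB : Disjoint A (Metric.ball x₀ (2 * r)) := disjoint_sdiff_left
  have hA0 : volume A ≠ 0 := by
    intro h
    have h1 : volume A₀ ≤ volume A + volume (Metric.ball x₀ (2 * r)) :=
      (measure_mono (by rw [hAdef]; intro x hx; by_cases h : x ∈ Metric.ball x₀ (2 * r) <;>
        simp_all)).trans (measure_union_le _ _)
    rw [h, zero_add] at h1
    exact absurd hε' (not_lt.2 (h1.trans hr2))
  obtain ⟨θ, hθ, hpot⟩ := hJ.exists_pos_le_potential hr hBH hAm hAH hAB hA0
  set k := farKernel J r with hk
  have hki : Integrable k := hJ.integrable_farKernel hr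
  -- the building blocks of the barrier
  set f := bump x₀ r with hf
  have hfm : Measurable f := (continuous_bump x₀ r).measurable
  have hf0 : ∀ x, 0 ≤ f x := bump_nonneg x₀ r
  have hf1 : ∀ x, f x ≤ r ^ 2 := bump_le x₀ r
  set χ : E n → ℝ := A.indicator 1 with hχ
  have hχm : Measurable χ := measurable_one.indicator hAm
  have hχ0 : ∀ x, 0 ≤ χ x := fun x => indicator_nonneg (fun _ _ => zero_le_one) x
  have hχ1 : ∀ x, χ x ≤ 1 := fun x => indicator_le_self' (fun _ _ => zero_le_one) x
  -- The weight `a` absorbs the bound `C₁` for the operator on `f`, the influence `C₂` of the mirror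
  -- image of `f`, and the zeroth order term; `ε` keeps the barrier below `w` on `A`.
  set C₁ := (1 + r ^ 2) * ∫ z, min 1 (‖z‖ ^ 2) * J z with hC₁
  set C₂ := r ^ 2 * ∫ z, k z with hC₂
  have hC₁0 : 0 ≤ C₁ := mul_nonneg (by positivity) (integral_nonneg fun z => by
    have := hJ.nonneg z; positivity)
  have hC₂0 : 0 ≤ C₂ := mul_nonneg (by positivity) (integral_nonneg (hJ.farKernel_nonneg r))
  set a := (C₁ + C₂ + L * r ^ 2) / θ with ha
  have ha0 : 0 ≤ a := by positivity
  have haθ : a * θ = C₁ + C₂ + L * r ^ 2 := div_mul_cancel₀ _ hθ.ne'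
  set ε := m / (a + 1) with hε
  have hε0 : 0 < ε := by positivity
  have hεa : ε * a ≤ m := by
    rw [hε, div_mul_eq_mul_div, div_le_iff₀ (by positivity)]
    nlinarith
  -- `f + ψ` is the antisymmetrization of `f + a 1_A`, and `ψ` vanishes near the support of `f`
  set ψ : E n → ℝ := fun x => - f (reflect l x) + a * (χ x - χ (reflect l x)) with hψ
  have hψm : Measurable ψ := by
    have h1 := hfm.comp (measurable_reflect (n := n) l)
    have h2 := hχm.comp (measurable_reflect (n := n) l)
    exact h1.neg.add ((hχm.sub h2).const_mul a)
  have hψb : ∀ x, |ψ x| ≤ r ^ 2 + a := by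
    intro x
    have h1 : |χ x - χ (reflect l x)| ≤ 1 :=
      abs_sub_le_of_nonneg_of_le (hχ0 _) (hχ1 _) (hχ0 _) (hχ1 _)
    rw [abs_le] at h1 ⊢
    have h2 := hf0 (reflect l x)
    have h3 := hf1 (reflect l x)
    constructor <;> simp only [hψ] <;> nlinarith
  have href : ∀ x, l < x 0 → f (reflect l x) = 0 ∧ χ (reflect l x) = 0 := by
    intro x hx
    have hx' : ¬ l < reflect l x 0 := by rw [reflect_apply_zero]; linarith
    exact ⟨bump_eq_zero hr.le fun h => hx' (hBH (hBB3 (hBB h))),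
      indicator_of_notMem (fun h => hx' (hAH h)) 1⟩
  have hψ0 : ∀ x ∈ Metric.ball x₀ (2 * r), ψ x = 0 := by
    intro x hx
    have h1 : χ x = 0 := indicator_of_notMem (fun h => disjoint_left.1 hAB h hx) 1
    have h2 := href x (hBH (hBB3 hx))
    simp [hψ, h1, h2.1, h2.2]
  set v : E n → ℝ := B.indicator fun x => max (ε * f x - w x) 0 with hv
  have hvm : Measurable v := by
    refine Measurable.indicator ?_ hBm
    fun_prop
  have hv0 : ∀ x, 0 ≤ v x := fun x => indicator_nonneg (fun _ _ => le_max_right _ _) x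
  have hvB : ∀ x, x ∉ B → v x = 0 := fun x hx => indicator_of_notMem hx _
  have hvle : ∀ x, v x ≤ B.indicator (fun _ => ε * r ^ 2 + M) x := by
    intro x
    refine indicator_le_indicator ?_
    have h1 := hw.bound x
    rw [abs_le] at h1
    have h2 := mul_le_mul_of_nonneg_left (hf1 x) hε0.le
    have h3 : 0 ≤ ε * r ^ 2 := by positivity
    refine max_le (by linarith) (by linarith)
  have hvi : Integrable v := by
    have h1 : Integrable (B.indicator fun _ => ε * r ^ 2 + M) :=
      (integrable_indicator_iff hBm).2
        (integrableOn_const (by simpa [B] using measure_ball_lt_top.ne))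
    refine h1.mono' hvm.aestronglyMeasurable (ae_of_all _ fun x => ?_)
    rw [Real.norm_of_nonneg (hv0 x)]
    exact hvle x
  -- `v` is the positive part of an antisymmetric function of finite energy
  have hve : energy J v < ∞ := by
    have hfe : energy J f < ∞ := hJ.energy_bump_lt_top x₀ hr.le
    have hfRm : Measurable fun x => f (reflect l x) := hfm.comp (measurable_reflect l)
    have hfRe : energy J (fun x => f (reflect l x)) < ∞ := by
      rwa [hJ.energy_comp_reflect]
    have h1 := hJ.energy_add_lt_top hfm hfRm hfe hfRe ε (-ε)
    have h2 := hJ.energy_add_lt_top (by fun_prop) hwm h1 hw.energy_lt_top 1 (-1)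
    refine hJ.energy_posPart_lt_top l (v := v) ?_ (by fun_prop) h2 ?_
    · intro x
      rw [hw.antisymm, reflect_reflect]; ring
    · filter_upwards [hw0] with x hx
      by_cases hxB : x ∈ B
      · have hxH : l < x 0 := hBH (hBB3 (hBB hxB))
        rw [if_pos hxH, hv, indicator_of_mem hxB, (href x hxH).1]
        congr 1; ring
      · rw [hvB x hxB]
        split_ifs with hxH
        · have : f x = 0 := bump_eq_zero hr.le hxB
          rw [(href x hxH).1, this, max_eq_right]
          linarith [hx hxH]
        · rfl
  have hvtest : IsTest J U v :=
    ⟨hvm, hv0, hvi, hve, fun x hx => hvB x fun h => hx (hBU (hBB3 (hBB h)))⟩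
  -- the difference of `w` and the barrier
  set W : E n → ℝ := fun x => w x - ε * (f x + ψ x) with hW
  have hWanti : ∀ x, W (reflect l x) = - W x := by
    intro x
    simp only [hW, hψ, hw.antisymm, reflect_reflect]; ring
  have hvW : ∀ᵐ x, v x = if l < x 0 then max (-W x) 0 else 0 := by
    filter_upwards [hw0] with x hx
    by_cases hxB : x ∈ B
    · have hxH : l < x 0 := hBH (hBB3 (hBB hxB))
      rw [if_pos hxH, hv, indicator_of_mem hxB]
      simp only [hW, hψ0 x (hBB hxB)]
      congr 1; ring
    · rw [hvB x hxB]
      split_ifs with hxH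
      · have h1 : f x = 0 := bump_eq_zero hr.le hxB
        simp only [hW, hψ, h1, (href x hxH).1, (href x hxH).2]
        rw [max_eq_right]
        by_cases hxA : x ∈ A
        · have h2 : χ x = 1 := indicator_of_mem hxA 1
          have h3 : m ≤ w x := hxA.1.2
          rw [h2]; linarith
        · have h2 : χ x = 0 := indicator_of_notMem hxA 1
          rw [h2]; linarith [hx hxH]
      · rfl
  have i1 := hJ.integrable_inc hwm hvm hw.energy_lt_top hve
  have i2 := hJ.integrable_inc hfm hvm (hJ.energy_bump_lt_top x₀ hr.le) hve
  obtain ⟨i3, e3⟩ := hJ.inc_of_separated hr hψm hψb hψ0 hvi hvB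
  have i23 : Integrable fun p => inc J f v p + inc J ψ v p := i2.add i3
  have hWv : inc J W v = fun p => inc J w v p - ε * (inc J f v p + inc J ψ v p) := by
    ext p; simp only [inc, hW]; ring
  have i4 : Integrable (inc J W v) := by
    rw [hWv]; exact i1.sub (i23.const_mul ε)
  have i5 : Integrable (inc J v v) := (hJ.energy_lt_top_iff hvm).1 hve
  have hmain := hJ.integral_inc_add_nonpos l hWanti hvW i4 i5
  have e4 : ∫ p, inc J W v p = (∫ p, inc J w v p) - ε * ((∫ p, inc J f v p) +
      ∫ p, inc J ψ v p) := by
    rw [hWv, integral_sub i1 (i23.const_mul ε), integral_const_mul]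
    rw [integral_add i2 i3]
  -- lower bound for the terms of `𝒥(W, v)`
  have b1 : -(L * (ε * r ^ 2)) * ∫ x, v x ≤ form J w v := by
    have h1 := hw.super v hvtest
    have h2 : ∫ x, |w x| * v x ≤ ∫ x, ε * r ^ 2 * v x := by
      refine integral_mono_ae (hvi.bdd_mul hwm.abs.aestronglyMeasurable (c := M)
        (ae_of_all _ fun x => by simpa using hw.bound x)) (hvi.const_mul _) ?_
      filter_upwards [hw0] with x hx
      by_cases hxB : x ∈ B
      · have hxH : l < x 0 := hBH (hBB3 (hBB hxB))
        have hvx : v x = max (ε * f x - w x) 0 := indicator_of_mem hxB _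
        rcases max_choice (ε * f x - w x) 0 with h | h
        · refine mul_le_mul_of_nonneg_right ?_ (hv0 x)
          rw [abs_of_nonneg (hx hxH)]
          have h3 := hv0 x
          rw [hvx, h] at h3
          have h4 := mul_le_mul_of_nonneg_left (hf1 x) hε0.le
          linarith
        · simp [hvx, h]
      · simp [hvB x hxB]
    rw [integral_const_mul] at h2
    nlinarith [mul_le_mul_of_nonneg_left h2 hL]
  have b2 : form J f v ≤ C₁ * ∫ x, v x := hJ.form_bump_le x₀ hr.le hvm hv0 hvi hve
  have b3 : (a * θ - C₂) * ∫ x, v x ≤ ∫ x, v x * ∫ y, ψ y * k (x - y) := by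
    rw [← integral_const_mul]
    have hint : Integrable fun x => v x * ∫ y, ψ y * k (x - y) := by
      have hc := continuous_integral_mul_sub hψm hψb hki
      refine hvi.mul_bdd (c := (r ^ 2 + a) * ∫ z, k z) hc.aestronglyMeasurable
        (ae_of_all _ fun x => ?_)
      refine (norm_integral_le_integral_norm _).trans ?_
      rw [← integral_const_mul, ← integral_sub_left_eq_self (fun z => (r ^ 2 + a) * k z) volume x]
      refine integral_mono_of_nonneg (ae_of_all _ fun y => norm_nonneg _)
        ((hki.comp_sub_left x).const_mul _) (ae_of_all _ fun y => ?_)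
      simp only [norm_mul]
      rw [Real.norm_of_nonneg (hJ.farKernel_nonneg r _)]
      exact mul_le_mul_of_nonneg_right (hψb y) (hJ.farKernel_nonneg r _)
    refine integral_mono (hvi.const_mul _) hint fun x => ?_
    simp only
    by_cases hxB : x ∈ B
    · rw [mul_comm (v x)]
      refine mul_le_mul_of_nonneg_right ?_ (hv0 x)
      have hkx := hki.comp_sub_left x
      have j1 : Integrable fun y => f (reflect l y) * k (x - y) :=
        hkx.bdd_mul (hfm.comp (measurable_reflect l)).aestronglyMeasurable (c := r ^ 2)
          (ae_of_all _ fun y => by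
            change ‖f (reflect l y)‖ ≤ r ^ 2
            rw [Real.norm_of_nonneg (hf0 _)]; exact hf1 _)
      have j2 : Integrable fun y => (χ y - χ (reflect l y)) * k (x - y) :=
        hkx.bdd_mul (hχm.sub (hχm.comp (measurable_reflect l))).aestronglyMeasurable (c := 1)
          (ae_of_all _ fun y => abs_sub_le_of_nonneg_of_le (hχ0 _) (hχ1 _) (hχ0 _) (hχ1 _))
      have e5 : ∫ y, ψ y * k (x - y) = a * (∫ y, (χ y - χ (reflect l y)) * k (x - y)) -
          ∫ y, f (reflect l y) * k (x - y) := by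
        rw [← integral_const_mul, ← integral_sub (j2.const_mul a) j1]
        congr 1; ext y; simp only [hψ]; ring
      have e6 : ∫ y, f (reflect l y) * k (x - y) ≤ C₂ := by
        rw [hC₂, ← integral_const_mul, ← integral_sub_left_eq_self (fun z => r ^ 2 * k z) volume x]
        exact integral_mono j1 (hkx.const_mul _) fun y =>
          mul_le_mul_of_nonneg_right (hf1 _) (hJ.farKernel_nonneg r _)
      have e7 := mul_le_mul_of_nonneg_left (hpot x hxB) ha0
      rw [e5]
      linarith
    · simp [hvB x hxB]
  have hnonpos : form J v v ≤ 0 := by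
    rw [form_eq] at b1 b2 ⊢
    rw [e4, e3] at hmain
    rw [haθ] at b3
    have c1 := mul_le_mul_of_nonneg_left b2 hε0.le
    have c2 := mul_le_mul_of_nonneg_left b3 hε0.le
    linarith
  -- hence `v` vanishes
  have hv2 : ∫⁻ x, ENNReal.ofReal (v x * v x) = 0 := by
    have h1 := hlow B v hBm ((measure_mono hBB).trans hr1) hvm hvB
    rw [hJ.energy_eq_ofReal i5, ENNReal.ofReal_eq_zero.2 hnonpos] at h1
    simpa using h1
  have hvz : ∀ᵐ x, v x = 0 := by
    rw [lintegral_eq_zero_iff (by fun_prop)] at hv2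
    filter_upwards [hv2] with x hx
    have := ENNReal.ofReal_eq_zero.1 hx
    nlinarith [hv0 x]
  refine ⟨r / 2, by positivity, ε * (r ^ 2 * (3 / 4)), by positivity, ?_⟩
  filter_upwards [hvz] with x hx hxr
  have hxB : x ∈ B := Metric.ball_subset_ball (by linarith) hxr
  rw [hv, indicator_of_mem hxB] at hx
  have h1 := le_max_left (ε * f x - w x) 0
  rw [hx] at h1
  have h2 : r ^ 2 - ‖x - x₀‖ ^ 2 ≤ f x := le_max_left _ _
  rw [Metric.mem_ball, dist_eq_norm] at hxr
  have h3 : r ^ 2 * (3 / 4) ≤ f x := by nlinarith [norm_nonneg (x - x₀)]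
  have h4 := mul_le_mul_of_nonneg_left h3 hε0.le
  linarith

end NiceKernel

/-! ### From solutions to antisymmetric supersolutions -/

/-- The part of `Ω` beyond the hyperplane `{x₁ = l}`. -/
def cap (Ω : Set (E n)) (l : ℝ) : Set (E n) := Ω ∩ {x | l < x 0}

/-- What the moving plane method uses of a solution: it is bounded, nonnegative, vanishes outside
`Ω` and, for `l ≥ 0`, the difference of its reflection and itself satisfies a linear
inequality in the cap beyond `{x₁ = l}`. -/
structure IsReflectionSuper (J : E n → ℝ) (Ω : Set (E n)) (L M : ℝ) (u : E n → ℝ) : Prop where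
  measurable : Measurable u
  nonneg : ∀ x, 0 ≤ u x
  le : ∀ x, u x ≤ M
  eq_zero : ∀ x, x ∉ Ω → u x = 0
  energy_lt_top : energy J u < ∞
  super : ∀ l, 0 ≤ l → ∀ φ, IsTest J (cap Ω l) φ →
    -L * ∫ x, |u (reflect l x) - u x| * φ x ≤ form J (fun x => u (reflect l x) - u x) φ

lemma CondD.reflect_mem {Ω : Set (E n)} (hD : CondD Ω) {l : ℝ} (hl : 0 ≤ l) {x : E n}
    (hx : x ∈ cap Ω l) : reflect l x ∈ Ω := by
  have h0 : l < x 0 := hx.2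
  have hx0 : 0 < x 0 := hl.trans_lt h0
  have := hD.steiner x hx.1 ((2 * l - x 0) / x 0)
    ⟨by rw [le_div_iff₀ hx0]; linarith, by rw [div_le_one hx0]; linarith⟩
  rwa [div_mul_cancel₀ _ hx0.ne'] at this

lemma CondF2.le_reflect {Ω : Set (E n)} {f : E n → ℝ → ℝ} (hF2 : CondF2 Ω f) {l : ℝ} (hl : 0 ≤ l)
    {x : E n} (hx : x ∈ cap Ω l) (τ : ℝ) : f x τ ≤ f (reflect l x) τ := by
  have h0 : l < x 0 := hx.2
  have hx0 : 0 < x 0 := hl.trans_lt h0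
  have := hF2 τ x hx.1 ((2 * l - x 0) / x 0)
    ⟨by rw [le_div_iff₀ hx0]; linarith, by rw [div_le_one hx0]; linarith⟩
  rwa [div_mul_cancel₀ _ hx0.ne'] at this

lemma CondD.reflect_zero_mem {Ω : Set (E n)} (hD : CondD Ω) {x : E n} (hx : x ∈ Ω) :
    reflect 0 x ∈ Ω := by
  have := hD.steiner x hx (-1) ⟨le_rfl, by norm_num⟩
  simpa [reflect] using this

lemma CondF2.reflect_zero_eq {Ω : Set (E n)} {f : E n → ℝ → ℝ} (hD : CondD Ω) (hF2 : CondF2 Ω f)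
    {x : E n} (hx : x ∈ Ω) (τ : ℝ) : f (reflect 0 x) τ = f x τ := by
  have h : ∀ y ∈ Ω, f y τ ≤ f (reflect 0 y) τ := fun y hy => by
    have := hF2 τ y hy (-1) ⟨le_rfl, by norm_num⟩
    simpa [reflect] using this
  have h2 := h _ (hD.reflect_zero_mem hx)
  rw [reflect_reflect] at h2
  exact le_antisymm h2 (h x hx)

lemma cap_subset (Ω : Set (E n)) (l : ℝ) : cap Ω l ⊆ Ω := inter_subset_left

lemma isOpen_cap {Ω : Set (E n)} (hΩ : IsOpen Ω) (l : ℝ) : IsOpen (cap Ω l) :=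
  hΩ.inter (isOpen_lt continuous_const (by fun_prop))

lemma IsTest.mem_formDomain {J : E n → ℝ} {U Ω : Set (E n)} {φ : E n → ℝ} (h : IsTest J U φ)
    (hU : U ⊆ Ω) : φ ∈ formDomain J Ω :=
  ⟨h.measurable.aemeasurable, h.energy_lt_top, ae_of_all _ fun x hx => h.eq_zero x fun h => hx (hU h)⟩

/-- Testing the equation with a test function on a cap and with its reflection, and using
(F1) and (F2), gives the linear inequality for the difference. -/
lemma IsSolution.isReflectionSuper {J : E n → ℝ} (hJ : NiceKernel J) {Ω : Set (E n)}
    (hD : CondD Ω) {f : E n → ℝ → ℝ} (hF2 : CondF2 Ω f) {L M : ℝ}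
    (hL : ∀ x ∈ Ω, ∀ σ ∈ Icc 0 M, ∀ τ ∈ Icc 0 M, |f x σ - f x τ| ≤ L * |σ - τ|)
    {u : E n → ℝ} (hsol : IsSolution J Ω f u) (hum : Measurable u) (hu0 : ∀ x, 0 ≤ u x)
    (huM : ∀ x, u x ≤ M) (huz : ∀ x, x ∉ Ω → u x = 0) : IsReflectionSuper J Ω L M u := by
  have hue := hsol.mem.2.1
  refine ⟨hum, hu0, huM, huz, hue, fun l hl φ hφ => ?_⟩
  set U := cap Ω l with hU
  have hUo : IsOpen U := isOpen_cap hD.isOpen l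
  have hφ1 := hφ.mem_formDomain (cap_subset Ω l)
  have hφ2 : (fun x => φ (reflect l x)) ∈ formDomain J Ω := by
    refine ⟨(hφ.measurable.comp (measurable_reflect l)).aemeasurable, ?_, ae_of_all _ fun x hx => ?_⟩
    · rw [hJ.energy_comp_reflect]; exact hφ.energy_lt_top
    · refine hφ.eq_zero _ fun h => hx ?_
      have := hD.reflect_mem hl h
      rwa [reflect_reflect] at this
  -- the change of variables `x ↦ reflect l x` in the equation tested with `φ ∘ reflect l`
  have hind : ∀ x, Ω.indicator (fun y => f y (u y) * φ (reflect l y)) (reflect l x) =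
      U.indicator (fun x => f (reflect l x) (u (reflect l x)) * φ x) x := by
    intro x
    by_cases hx : x ∈ U
    · rw [indicator_of_mem hx, indicator_of_mem (hD.reflect_mem hl hx), reflect_reflect]
    · rw [indicator_of_notMem hx]
      by_cases h : reflect l x ∈ Ω
      · rw [indicator_of_mem h, reflect_reflect, hφ.eq_zero x hx, mul_zero]
      · rw [indicator_of_notMem h]
  have i2 : IntegrableOn (fun x => f (reflect l x) (u (reflect l x)) * φ x) U := by
    have h := hsol.integrable _ hφ2
    rw [← integrable_indicator_iff hD.isOpen.measurableSet] at h
    have h2 := (measurePreserving_reflect l).integrable_comp_of_integrable h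
    rw [← integrable_indicator_iff hUo.measurableSet]
    exact h2.congr (ae_of_all _ hind)
  have e2 : form J (fun x => u (reflect l x)) φ =
      ∫ x in U, f (reflect l x) (u (reflect l x)) * φ x := by
    rw [hJ.form_comp_reflect, hsol.eq _ hφ2, ← integral_indicator hD.isOpen.measurableSet,
      ← integral_indicator hUo.measurableSet, ← integral_comp_reflect l]
    exact integral_congr_ae (ae_of_all _ hind)
  have i1 : IntegrableOn (fun x => f x (u x) * φ x) U :=
    (hsol.integrable _ hφ1).mono_set (cap_subset Ω l)
  have e1 : form J u φ = ∫ x in U, f x (u x) * φ x := by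
    rw [hsol.eq _ hφ1]
    refine (setIntegral_eq_of_subset_of_forall_sdiff_eq_zero hD.isOpen.measurableSet
      (cap_subset Ω l) fun x hx => ?_)
    rw [hφ.eq_zero x hx.2, mul_zero]
  have huR : Measurable fun x => u (reflect l x) := hum.comp (measurable_reflect l)
  have e3 : form J (fun x => u (reflect l x) - u x) φ =
      form J (fun x => u (reflect l x)) φ - form J u φ := by
    rw [form_eq, form_eq, form_eq, ← mul_sub, ← integral_sub
      (hJ.integrable_inc huR hφ.measurable (by rwa [hJ.energy_comp_reflect]) hφ.energy_lt_top)
      (hJ.integrable_inc hum hφ.measurable hue hφ.energy_lt_top)]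
    congr 2; ext p; simp only [inc]; ring
  rw [e3, e2, e1, ← integral_sub i2 i1]
  have i3 : Integrable fun x => |u (reflect l x) - u x| * φ x := by
    refine hφ.integrable.bdd_mul (c := M) (huR.sub hum).abs.aestronglyMeasurable
      (ae_of_all _ fun x => ?_)
    simp only [Real.norm_eq_abs, abs_abs]
    exact abs_sub_le_of_nonneg_of_le (hu0 _) (huM _) (hu0 _) (huM _)
  have e4 : ∫ x, |u (reflect l x) - u x| * φ x = ∫ x in U, |u (reflect l x) - u x| * φ x := by
    rw [setIntegral_eq_integral_of_forall_compl_eq_zero fun x hx => ?_]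
    rw [hφ.eq_zero x hx, mul_zero]
  rw [e4, ← integral_const_mul]
  refine setIntegral_mono_on (i3.integrableOn.const_mul _) (i2.sub i1) hUo.measurableSet
    fun x hx => ?_
  rw [← mul_assoc, ← sub_mul]
  refine mul_le_mul_of_nonneg_right ?_ (hφ.nonneg x)
  have h1 := hF2.le_reflect hl hx (u (reflect l x))
  have h2 := hL x hx.1 (u (reflect l x)) ⟨hu0 _, huM _⟩ (u x) ⟨hu0 _, huM _⟩
  rw [abs_le] at h2
  linarith [h2.1]

/-- The reflection of a solution is a solution. -/
lemma IsSolution.comp_reflect {J : E n → ℝ} (hJ : NiceKernel J) {Ω : Set (E n)}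
    (hD : CondD Ω) {f : E n → ℝ → ℝ} (hF2 : CondF2 Ω f) {u : E n → ℝ}
    (hsol : IsSolution J Ω f u) :
    IsSolution J Ω f (fun x => u (reflect 0 x)) := by
  have hdom : ∀ φ ∈ formDomain J Ω, (fun x => φ (reflect 0 x)) ∈ formDomain J Ω := by
    intro φ hφ
    refine ⟨hφ.1.comp_quasiMeasurePreserving (measurePreserving_reflect 0).quasiMeasurePreserving,
      ?_, ?_⟩
    · rw [hJ.energy_comp_reflect]; exact hφ.2.1
    · filter_upwards [ae_reflect 0 hφ.2.2] with x hx hxΩ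
      refine hx fun h => hxΩ ?_
      have := hD.reflect_zero_mem h
      rwa [reflect_reflect] at this
  have hind : ∀ (φ : E n → ℝ) x,
      Ω.indicator (fun y => f y (u y) * φ (reflect 0 y)) (reflect 0 x) =
      Ω.indicator (fun x => f x (u (reflect 0 x)) * φ x) x := by
    intro φ x
    by_cases hx : x ∈ Ω
    · rw [indicator_of_mem hx, indicator_of_mem (hD.reflect_zero_mem hx), reflect_reflect,
        hF2.reflect_zero_eq hD hx]
    · have h : reflect 0 x ∉ Ω := fun h => hx (by
        have := hD.reflect_zero_mem h
        rwa [reflect_reflect] at this)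
      rw [indicator_of_notMem hx, indicator_of_notMem h]
  refine ⟨hdom u hsol.mem, fun φ hφ => ?_, fun φ hφ => ?_⟩
  · have h := hsol.integrable _ (hdom φ hφ)
    rw [← integrable_indicator_iff hD.isOpen.measurableSet] at h ⊢
    have h2 := (measurePreserving_reflect 0).integrable_comp_of_integrable h
    exact h2.congr (ae_of_all _ (hind φ))
  · rw [hJ.form_comp_reflect, hsol.eq _ (hdom φ hφ), ← integral_indicator hD.isOpen.measurableSet,
      ← integral_indicator hD.isOpen.measurableSet, ← integral_comp_reflect 0]
    exact integral_congr_ae (ae_of_all _ (hind φ))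

lemma formDomain_congr {J J' : E n → ℝ} (h : J =ᵐ[volume] J') (Ω : Set (E n)) :
    formDomain J Ω = formDomain J' Ω := by
  ext u
  simp only [formDomain, mem_ofPred_eq, energy_congr h (EventuallyEq.refl _ u)]

lemma IsSolution.congr {J J' : E n → ℝ} (hJ : J =ᵐ[volume] J') {Ω : Set (E n)}
    {f : E n → ℝ → ℝ} {u u' : E n → ℝ} (hu : u =ᵐ[volume] u')
    (hsol : IsSolution J Ω f u) : IsSolution J' Ω f u' := by
  have hf : ∀ φ : E n → ℝ, (fun x => f x (u x) * φ x) =ᵐ[volume.restrict Ω]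
      fun x => f x (u' x) * φ x := fun φ => by
    filter_upwards [ae_restrict_of_ae hu] with x hx
    rw [hx]
  obtain ⟨h1, h2, h3⟩ := hsol.mem
  refine ⟨⟨h1.congr hu, ?_, ?_⟩, fun φ hφ => ?_, fun φ hφ => ?_⟩
  · rwa [← energy_congr hJ hu]
  · filter_upwards [hu, h3] with x a b hx
    rw [← a, b hx]
  · rw [← formDomain_congr hJ] at hφ
    exact (hsol.integrable φ hφ).congr (hf φ)
  · rw [← formDomain_congr hJ] at hφ
    rw [← form_congr hJ hu (EventuallyEq.refl _ φ), hsol.eq φ hφ]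
    exact integral_congr_ae (hf φ)

namespace IsReflectionSuper

variable {J : E n → ℝ} {Ω : Set (E n)} {L M : ℝ} {u : E n → ℝ}

lemma isAntisymmSuper (hJ : NiceKernel J) (hu : IsReflectionSuper J Ω L M u) {l : ℝ}
    (hl : 0 ≤ l) : IsAntisymmSuper J l (cap Ω l) L M (fun x => u (reflect l x) - u x) := by
  have hR : Measurable fun x => u (reflect l x) := hu.measurable.comp (measurable_reflect l)
  refine ⟨hR.sub hu.measurable, fun x => ?_, fun x =>
    abs_sub_le_of_nonneg_of_le (hu.nonneg _) (hu.le _) (hu.nonneg _) (hu.le _), ?_, hu.super l hl⟩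
  · simp
  · have := hJ.energy_add_lt_top hR hu.measurable (by
      rw [hJ.energy_comp_reflect]; exact hu.energy_lt_top) hu.energy_lt_top 1 (-1)
    simpa only [one_mul, neg_mul, ← sub_eq_add_neg] using this

end IsReflectionSuper

/-! ### The moving plane method -/

lemma dist_reflect (l : ℝ) (x y : E n) : dist (reflect l x) (reflect l y) = dist x y := by
  rw [dist_eq_norm, dist_eq_norm, reflect_sub_reflect, ← reflectLinear_apply,
    LinearIsometryEquiv.norm_map]

/-- `u` is almost everywhere at most its reflection, on the half space beyond `{x₁ = l}`. -/
def ReflectLE (u : E n → ℝ) (l : ℝ) : Prop := ∀ᵐ x, l < x 0 → u x ≤ u (reflect l x)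

/-- `g` is bounded below by a positive constant almost everywhere near `x`. -/
def LocallyPos (g : E n → ℝ) (x : E n) : Prop :=
  ∃ r > 0, ∃ c > 0, ∀ᵐ y, y ∈ Metric.ball x r → c ≤ g y

lemma essInfPos_of_locallyPos {g : E n → ℝ} {K : Set (E n)} (hK : IsCompact K)
    (h : ∀ x ∈ K, LocallyPos g x) : EssInfPos K g := by
  refine hK.induction_on (p := fun s => ∃ c : ℝ, 0 < c ∧ ∀ᵐ x, x ∈ s → c ≤ g x)
    ⟨1, one_pos, by simp⟩ ?_ ?_ ?_ |>.imp fun c hc => ⟨hc.1, ?_⟩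
  · rintro s t hst ⟨c, hc, h⟩
    exact ⟨c, hc, h.mono fun x hx hxs => hx (hst hxs)⟩
  · rintro s t ⟨c, hc, h⟩ ⟨d, hd, h'⟩
    refine ⟨min c d, lt_min hc hd, ?_⟩
    filter_upwards [h, h'] with x hx hx' hxst
    rcases hxst with hs | ht
    · exact (min_le_left _ _).trans (hx hs)
    · exact (min_le_right _ _).trans (hx' ht)
  · intro x hx
    obtain ⟨r, hr, c, hc, h⟩ := h x hx
    exact ⟨Metric.ball x r, mem_nhdsWithin_of_mem_nhds (Metric.ball_mem_nhds x hr), c, hc, h⟩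
  · exact (ae_restrict_iff' hK.measurableSet).2 hc.2

lemma ae_pos_of_locallyPos {g : E n → ℝ} {U : Set (E n)} (h : ∀ x ∈ U, LocallyPos g x) :
    ∀ᵐ x, x ∈ U → 0 < g x := by
  rw [ae_iff]
  refine measure_null_of_locally_null _ fun x hx => ?_
  simp only [Classical.not_imp, mem_ofPred_eq] at hx
  obtain ⟨r, hr, c, hc, hx'⟩ := h x hx.1
  refine ⟨_, inter_mem_nhdsWithin _ (Metric.ball_mem_nhds x hr), ?_⟩
  refine measure_mono_null ?_ (ae_iff.1 hx')
  rintro y ⟨hy1, hy2⟩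
  simp only [Classical.not_imp, mem_ofPred_eq] at hy1 ⊢
  exact ⟨hy2, fun h => hy1.2 (hc.trans_le h)⟩

namespace IsReflectionSuper

variable {J : E n → ℝ} {Ω : Set (E n)} {L M : ℝ} {u : E n → ℝ}

lemma integrable (hD : CondD Ω) (hu : IsReflectionSuper J Ω L M u) : Integrable u := by
  have h1 : Integrable (Ω.indicator fun _ => M) :=
    (integrable_indicator_iff hD.isOpen.measurableSet).2
      (integrableOn_const (by simpa using hD.isBounded.measure_lt_top.ne))
  refine h1.mono' hu.measurable.aestronglyMeasurable (ae_of_all _ fun x => ?_)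
  rw [Real.norm_of_nonneg (hu.nonneg x)]
  by_cases hx : x ∈ Ω
  · rw [indicator_of_mem hx]; exact hu.le x
  · rw [indicator_of_notMem hx, hu.eq_zero x hx]

lemma measurableSet_lt_reflect (hu : IsReflectionSuper J Ω L M u) (l : ℝ) :
    MeasurableSet {x : E n | l < x 0 ∧ u (reflect l x) < u x} := by
  have h : MeasurableSet {x : E n | l < x 0} := measurableSet_lt measurable_const (by fun_prop)
  exact h.inter (measurableSet_lt (hu.measurable.comp (measurable_reflect l)) hu.measurable)

lemma lt_reflect_subset (hu : IsReflectionSuper J Ω L M u) (l : ℝ) :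
    {x : E n | l < x 0 ∧ u (reflect l x) < u x} ⊆ cap Ω l := by
  rintro x ⟨h1, h2⟩
  refine ⟨?_, h1⟩
  by_contra h
  rw [hu.eq_zero x h] at h2
  exact absurd (hu.nonneg (reflect l x)) (not_le.2 h2)

/-- The maximum principle for sets of small volume. -/
lemma exists_reflectLE_of_measure_le (hJ : NiceKernel J) (hD : CondD Ω) (hL : 0 ≤ L)
    (hu : IsReflectionSuper J Ω L M u) : ∃ δ : ℝ≥0∞, 0 < δ ∧ ∀ l, 0 ≤ l →
      volume {x : E n | l < x 0 ∧ u (reflect l x) < u x} ≤ δ → ReflectLE u l := by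
  obtain ⟨δ, hδ, hlow⟩ := hJ.exists_energy_ge (L + 1)
  refine ⟨δ, hδ, fun l hl hvol => ?_⟩
  have hw := hu.isAntisymmSuper hJ hl
  set A := {x : E n | l < x 0 ∧ u (reflect l x) < u x} with hA
  have hAm : MeasurableSet A := hu.measurableSet_lt_reflect l
  have hAU : A ⊆ cap Ω l := hu.lt_reflect_subset l
  set w : E n → ℝ := fun x => u (reflect l x) - u x with hwdef
  have hwm : Measurable w := hw.measurable
  set v : E n → ℝ := fun x => if l < x 0 then max (-w x) 0 else 0 with hv
  have hvm : Measurable v := by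
    refine Measurable.ite (measurableSet_lt measurable_const (by fun_prop)) ?_ measurable_const
    fun_prop
  have hv0 : ∀ x, 0 ≤ v x := fun x => by
    simp only [hv]; split_ifs
    · exact le_max_right _ _
    · exact le_rfl
  have hvA : ∀ x, x ∉ A → v x = 0 := by
    intro x hx
    simp only [hv]
    split_ifs with h
    · refine max_eq_right ?_
      have : ¬ u (reflect l x) < u x := fun h2 => hx ⟨h, h2⟩
      simp only [hwdef]; linarith
    · rfl
  have hvu : ∀ x, v x ≤ u x := by
    intro x
    simp only [hv]
    split_ifs
    · refine max_le ?_ (hu.nonneg x)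
      have := hu.nonneg (reflect l x)
      simp only [hwdef]; linarith
    · exact hu.nonneg x
  have hvi : Integrable v := (hu.integrable hD).mono' hvm.aestronglyMeasurable
    (ae_of_all _ fun x => by rw [Real.norm_of_nonneg (hv0 x)]; exact hvu x)
  have hve : energy J v < ∞ := by
    have h1 := hJ.energy_add_lt_top hwm hwm hw.energy_lt_top hw.energy_lt_top (-1) 0
    refine hJ.energy_posPart_lt_top l (v := v) ?_ (by fun_prop) h1 (ae_of_all _ fun x => ?_)
    · intro x; rw [hw.antisymm]; ring
    · simp only [hv, neg_mul, one_mul, zero_mul, add_zero]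
  have hvt : IsTest J (cap Ω l) v := ⟨hvm, hv0, hvi, hve, fun x hx => hvA x fun h => hx (hAU h)⟩
  have hvv : Integrable (inc J v v) := (hJ.energy_lt_top_iff hvm).1 hve
  have h1 := hw.super v hvt
  have h2 := hJ.integral_inc_add_nonpos l hw.antisymm (ae_of_all _ fun x => rfl)
    (hJ.integrable_inc hwm hvm hw.energy_lt_top hve) hvv
  have h3 : ∫ x, |w x| * v x = ∫ x, v x * v x := by
    congr 1; ext x
    by_cases hx : x ∈ A
    · have h4 : w x < 0 := by simp only [hwdef]; linarith [hx.2]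
      have h5 : v x = -w x := by
        simp only [hv, if_pos hx.1]; exact max_eq_left (by linarith)
      rw [h5, abs_of_neg h4]
    · rw [hvA x hx]; simp
  have hvvi : Integrable fun x => v x * v x :=
    hvi.bdd_mul hvm.aestronglyMeasurable (c := M) (ae_of_all _ fun x => by
      rw [Real.norm_of_nonneg (hv0 x)]; exact (hvu x).trans (hu.le x))
  have h4 := hlow A v hAm hvol hvm hvA
  rw [hJ.energy_eq_ofReal hvv, ← ofReal_integral_eq_lintegral_ofReal hvvi
    (ae_of_all _ fun x => mul_self_nonneg _), ← ENNReal.ofReal_mul (by positivity)] at h4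
  have h5 : 0 ≤ form J v v := mul_nonneg (by norm_num)
    (integral_nonneg (hJ.inc_self_nonneg v))
  rw [ENNReal.ofReal_le_ofReal_iff h5] at h4
  have h6 : form J w v + form J v v ≤ 0 := by
    rw [form_eq, form_eq]; linarith
  have h7 : ∫ x, v x * v x = 0 := by
    refine le_antisymm ?_ (integral_nonneg fun x => mul_self_nonneg _)
    rw [h3] at h1
    linarith
  rw [integral_eq_zero_iff_of_nonneg (fun x => mul_self_nonneg _) hvvi] at h7
  filter_upwards [h7] with x hx hxl
  have h8 : v x = 0 := mul_self_eq_zero.1 hx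
  simp only [hv, if_pos hxl] at h8
  have h9 := le_max_left (-w x) 0
  rw [h8] at h9
  simp only [hwdef] at h9
  linarith

lemma exists_subseq_tendsto (hD : CondD Ω) (hu : IsReflectionSuper J Ω L M u) {s : ℕ → ℝ} {l : ℝ}
    (hs : Tendsto s atTop (𝓝 l)) : ∃ ns : ℕ → ℕ, StrictMono ns ∧
      ∀ᵐ x, Tendsto (fun k => u (reflect (s (ns k)) x)) atTop (𝓝 (u (reflect l x))) := by
  have hG : Continuous (Function.uncurry fun (t : ℝ) (x : E n) => reflect t x) := by
    have : (Function.uncurry fun (t : ℝ) (x : E n) => reflect t x) =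
        fun p : ℝ × E n => reflectLinear n p.2 + (2 * p.1) • e₁ n := by
      ext1 p
      rw [Function.uncurry, reflect_eq_add, reflectLinear_apply]
    rw [this]; fun_prop
  have h := (tendsto_lintegral_enorm_comp_sub hG measurePreserving_reflect (hu.integrable hD)
    l).comp hs
  have hm : ∀ t, AEStronglyMeasurable (fun x => u (reflect t x)) volume := fun t =>
    (hu.measurable.comp (measurable_reflect t)).aestronglyMeasurable
  refine (tendstoInMeasure_of_tendsto_eLpNorm (p := 1) one_ne_zero (fun k => hm (s k)) (hm l)
    (h.congr fun k => ?_)).exists_seq_tendsto_ae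
  rw [eLpNorm_one_eq_lintegral_enorm]
  rfl

lemma reflectLE_of_tendsto (hD : CondD Ω) (hu : IsReflectionSuper J Ω L M u) {s : ℕ → ℝ} {l : ℝ}
    (hs : Tendsto s atTop (𝓝 l)) (h : ∀ k, ReflectLE u (s k)) : ReflectLE u l := by
  obtain ⟨ns, hns, hlim⟩ := hu.exists_subseq_tendsto hD hs
  filter_upwards [hlim, ae_all_iff.2 h] with x hx hle hxl
  refine ge_of_tendsto hx ?_
  filter_upwards [(hs.comp hns.tendsto_atTop).eventually (gt_mem_nhds hxl)] with k hk
  exact hle (ns k) hk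

/-- The planes can be moved a bit further if the inequality is strict. -/
lemma exists_reflectLE_of_tendsto (hJ : NiceKernel J) (hD : CondD Ω) (hL : 0 ≤ L)
    (hu : IsReflectionSuper J Ω L M u) {s : ℕ → ℝ} {l : ℝ} (hs : Tendsto s atTop (𝓝 l))
    (hs0 : ∀ k, 0 ≤ s k) (hlt : ∀ᵐ x, x ∈ cap Ω l → u x < u (reflect l x)) :
    ∃ k, ReflectLE u (s k) := by
  obtain ⟨δ, hδ, hsmall⟩ := hu.exists_reflectLE_of_measure_le hJ hD hL
  obtain ⟨ns, hns, hlim⟩ := hu.exists_subseq_tendsto hD hs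
  have hs' := hs.comp hns.tendsto_atTop
  set A : ℕ → Set (E n) := fun k =>
    {x : E n | s (ns k) < x 0 ∧ u (reflect (s (ns k)) x) < u x} with hA
  have : IsFiniteMeasure (volume.restrict Ω : Measure (E n)) :=
    ⟨by simpa using hD.isBounded.measure_lt_top⟩
  have hmem : ∀ᵐ x ∂(volume.restrict Ω), ∀ᶠ k in atTop, x ∈ A k ↔ x ∈ (∅ : Set (E n)) := by
    rw [ae_restrict_iff' hD.isOpen.measurableSet]
    filter_upwards [hlim, hlt, ae_first_ne l] with x hx hxlt hne hxΩ
    simp only [mem_empty_iff_false, iff_false]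
    rcases lt_or_gt_of_ne hne with h | h
    · filter_upwards [hs'.eventually (lt_mem_nhds h)] with k hk hk'
      exact lt_asymm hk hk'.1
    · filter_upwards [hx.eventually (lt_mem_nhds (hxlt ⟨hxΩ, h⟩))] with k hk hk'
      exact lt_asymm hk hk'.2
  have hmeas := tendsto_measure_of_ae_tendsto_indicator_of_isFiniteMeasure atTop
    MeasurableSet.empty (fun k => hu.measurableSet_lt_reflect (s (ns k))) hmem
  rw [measure_empty] at hmeas
  obtain ⟨k, hk⟩ := (hmeas.eventually_le_const hδ).exists
  refine ⟨ns k, hsmall _ (hs0 _) ?_⟩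
  rwa [Measure.restrict_apply (hu.measurableSet_lt_reflect _), inter_eq_left.2
    ((hu.lt_reflect_subset _).trans (cap_subset _ _))] at hk

/-- The strong maximum principle for the difference of the reflection of `u` and `u`. -/
lemma locallyPos (hJ : NiceKernel J) (hD : CondD Ω) (hL : 0 ≤ L)
    (hu : IsReflectionSuper J Ω L M u) {l : ℝ} (hl : 0 ≤ l) (hle : ReflectLE u l)
    (hne : ¬ ∀ᵐ x, l < x 0 → u (reflect l x) = u x) {x : E n} (hx : x ∈ cap Ω l) :
    LocallyPos (fun x => u (reflect l x) - u x) x :=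
  hJ.strong_maximum_principle hL (isOpen_cap hD.isOpen l) inter_subset_right
    (hu.isAntisymmSuper hJ hl)
    (hle.mono fun _ hy hyl => sub_nonneg.2 (hy hyl))
    (fun h => hne (h.mono fun _ hy hyl => sub_eq_zero.1 (hy hyl))) hx

/-- Symmetry with respect to a hyperplane off the origin forces `u` to vanish. Such a `u` vanishes
in the part of `Ω` whose mirror image leaves `Ω`, so that `u ∘ R`, where `R` is the reflection at
`{x₁ = 0}`, vanishes at the far end of `Ω`. For a hyperplane `{x₁ = m}` close to this end the
difference of the reflection of `u ∘ R` and `u ∘ R` is therefore nonnegative in the half space and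
zero in the cap, and thus zero by the strong maximum principle. -/
lemma ae_eq_zero_of_reflect_eq (hJ : NiceKernel J) (hD : CondD Ω) (hL : 0 ≤ L)
    (hu : IsReflectionSuper J Ω L M u)
    (hu' : IsReflectionSuper J Ω L M (fun x => u (reflect 0 x))) {l : ℝ} (hl : 0 < l)
    (h : ∀ᵐ x, l < x 0 → u (reflect l x) = u x) : ∀ᵐ x, u x = 0 := by
  rcases Ω.eq_empty_or_nonempty with rfl | ⟨z, hz⟩
  · exact ae_of_all _ fun x => hu.eq_zero x (notMem_empty x)
  set T : Set ℝ := (fun x : E n => x 0) '' Ω with hT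
  have hTb : BddAbove T := by
    obtain ⟨R, hR⟩ := hD.isBounded.exists_norm_le
    refine ⟨R, ?_⟩
    rintro _ ⟨x, hx, rfl⟩
    exact (le_abs_self _).trans ((PiLp.norm_apply_le x 0).trans (hR x hx))
  set b := sSup T with hb
  have hbΩ : ∀ x ∈ Ω, x 0 ≤ b := fun x hx => le_csSup hTb ⟨x, hx, rfl⟩
  have hb0 : 0 < b := by
    obtain ⟨ρ, hρ, hρΩ⟩ := Metric.isOpen_iff.1 hD.isOpen z hz
    have hn : ‖e₁ n‖ = 1 := by simp [e₁]
    have h1 : z + (ρ / 2) • e₁ n ∈ Ω := hρΩ (by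
      rw [Metric.mem_ball, dist_eq_norm, add_sub_cancel_left, norm_smul, hn, Real.norm_of_nonneg
        (by positivity)]
      linarith)
    have h2 := hbΩ _ h1
    have h3 := hbΩ _ (hD.reflect_zero_mem hz)
    simp at h2 h3
    linarith
  -- reflection symmetry on the whole space
  have hall : ∀ᵐ x, u (reflect l x) = u x := by
    filter_upwards [h, ae_reflect l h, ae_first_ne l] with x h1 h2 h3
    rw [reflect_reflect, reflect_apply_zero] at h2
    rcases lt_or_gt_of_ne h3 with h4 | h4
    · exact (h2 (by linarith)).symm
    · exact h1 h4
  have hvan : ∀ᵐ x, b - 2 * l < x 0 → u (reflect 0 x) = 0 := by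
    filter_upwards [ae_reflect 0 hall] with x hx hxb
    rw [← hx]
    refine hu.eq_zero _ fun hmem => ?_
    have := hbΩ _ hmem
    simp at this
    linarith
  -- for such `m` both the half space beyond `{x₁ = m}` and the mirror image of the cap lie in
  -- `{x₁ > b - 2 l}`, where `u ∘ R` vanishes
  set m := max (b - l / 2) (b / 2) with hm
  have hm1 : b - l / 2 ≤ m := le_max_left _ _
  have hm2 : b / 2 ≤ m := le_max_right _ _
  have hm3 : m < b := max_lt (by linarith) (by linarith)
  have hvan2 : ∀ᵐ x, m < x 0 → u (reflect 0 x) = 0 := by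
    filter_upwards [hvan] with x hx h
    exact hx (by linarith)
  have hle : ReflectLE (fun x => u (reflect 0 x)) m := by
    filter_upwards [hvan2] with x hx h
    rw [hx h]
    exact hu.nonneg _
  have hcap : ∀ᵐ x, x ∈ cap Ω m → u (reflect 0 (reflect m x)) - u (reflect 0 x) = 0 := by
    filter_upwards [hvan2, ae_reflect m hvan] with x h1 h2 hx
    have h3 : m < x 0 := hx.2
    have h4 := hbΩ x hx.1
    rw [h1 h3, h2 (by rw [reflect_apply_zero]; linarith), sub_zero]
  obtain ⟨_, ⟨y, hy, rfl⟩, hym⟩ := exists_lt_of_lt_csSup (⟨_, z, hz, rfl⟩ : T.Nonempty) hm3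
  have hzero : ∀ᵐ x, m < x 0 → u (reflect 0 (reflect m x)) = u (reflect 0 x) := by
    by_contra hne
    have hpos := ae_pos_of_locallyPos fun x hx =>
      hu'.locallyPos hJ hD hL (by linarith) hle hne (x := x) hx
    have hnull : volume (cap Ω m) = 0 := by
      refine measure_mono_null (t := {x | ¬ (x ∉ cap Ω m)}) (fun x hx => not_not.2 hx) ?_
      rw [← ae_iff]
      filter_upwards [hpos, hcap] with x h1 h2 h3
      exact absurd (h2 h3) (h1 h3).ne'
    exact ((isOpen_cap hD.isOpen m).measure_pos volume ⟨y, hy, hym⟩).ne' hnull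
  refine ae_of_ae_reflect 0 ?_
  filter_upwards [hvan2, ae_reflect m hvan2, ae_reflect m hzero, ae_first_ne m] with x h1 h2 h3 h4
  rcases lt_or_gt_of_ne h4 with h5 | h5
  · rw [reflect_reflect, reflect_apply_zero] at h3
    rw [h3 (by linarith)]
    exact h2 (by rw [reflect_apply_zero]; linarith)
  · exact h1 h5

/-- The moving plane argument: the planes can be moved from the far end of `Ω` to the origin. -/
lemma reflectLE (hJ : NiceKernel J) (hD : CondD Ω) (hL : 0 ≤ L)
    (hu : IsReflectionSuper J Ω L M u)
    (hu' : IsReflectionSuper J Ω L M (fun x => u (reflect 0 x))) (hne : ¬ ∀ᵐ x, u x = 0) {l : ℝ}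
    (hl : 0 < l) : ReflectLE u l := by
  by_contra hcon
  set S : Set ℝ := {t | 0 < t ∧ ¬ ReflectLE u t} with hS
  obtain ⟨R, hR⟩ := hD.isBounded.exists_norm_le
  -- beyond `Ω` there is nothing to prove
  have hSb : BddAbove S := by
    refine ⟨R, fun t ht => ?_⟩
    by_contra! hRt
    refine ht.2 (ae_of_all _ fun x hx => ?_)
    have hxΩ : x ∉ Ω := fun h => by
      have := (le_abs_self _).trans ((PiLp.norm_apply_le x 0).trans (hR x h))
      linarith
    rw [hu.eq_zero x hxΩ]
    exact hu.nonneg _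
  have hlS : l ∈ S := ⟨hl, hcon⟩
  set b := sSup S with hb
  have hb0 : 0 < b := hl.trans_le (le_csSup hSb hlS)
  have hbS : ∀ t, b < t → ReflectLE u t := fun t ht => by
    by_contra h
    exact absurd (le_csSup hSb (⟨hb0.trans ht, h⟩ : t ∈ S)) (not_le.2 ht)
  have hPb : ReflectLE u b := by
    refine hu.reflectLE_of_tendsto hD (s := fun k : ℕ => b + 1 / ((k : ℝ) + 1)) ?_ fun k =>
      hbS _ (by have : (0 : ℝ) < 1 / ((k : ℝ) + 1) := by positivity
                linarith)
    simpa using (tendsto_one_div_add_atTop_nhds_zero_nat (𝕜 := ℝ)).const_add b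
  have hneq : ¬ ∀ᵐ x, b < x 0 → u (reflect b x) = u x := fun h =>
    hne (hu.ae_eq_zero_of_reflect_eq hJ hD hL hu' hb0 h)
  have hpos := ae_pos_of_locallyPos fun x hx => hu.locallyPos hJ hD hL hb0.le hPb hneq (x := x) hx
  obtain ⟨s, -, hs, hsS⟩ := exists_seq_tendsto_sSup ⟨l, hlS⟩ hSb
  obtain ⟨k, hk⟩ := hu.exists_reflectLE_of_tendsto hJ hD hL hs (fun k => (hsS k).1.le)
    (hpos.mono fun x hx h => sub_pos.1 (hx h))
  exact (hsS k).2 hk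

lemma locallyPos_of_pos (hJ : NiceKernel J) (hD : CondD Ω) (hL : 0 ≤ L)
    (hu : IsReflectionSuper J Ω L M u)
    (hu' : IsReflectionSuper J Ω L M (fun x => u (reflect 0 x))) (hne : ¬ ∀ᵐ x, u x = 0) {l : ℝ}
    (hl : 0 < l) {x : E n} (hx : x ∈ cap Ω l) :
    LocallyPos (fun x => u (reflect l x) - u x) x :=
  hu.locallyPos hJ hD hL hl.le (hu.reflectLE hJ hD hL hu' hne hl)
    (fun h => hne (hu.ae_eq_zero_of_reflect_eq hJ hD hL hu' hl h)) hx

lemma reflectLE_zero (hJ : NiceKernel J) (hD : CondD Ω) (hL : 0 ≤ L)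
    (hu : IsReflectionSuper J Ω L M u)
    (hu' : IsReflectionSuper J Ω L M (fun x => u (reflect 0 x))) (hne : ¬ ∀ᵐ x, u x = 0) :
    ReflectLE u 0 :=
  hu.reflectLE_of_tendsto hD (tendsto_one_div_add_atTop_nhds_zero_nat (𝕜 := ℝ)) fun k =>
    hu.reflectLE hJ hD hL hu' hne (by positivity)

/-- Positivity of `u` at a point follows from strict monotonicity across a hyperplane slightly
beyond this point. -/
lemma locallyPos_self (hJ : NiceKernel J) (hD : CondD Ω) (hL : 0 ≤ L)
    (hu : IsReflectionSuper J Ω L M u)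
    (hu' : IsReflectionSuper J Ω L M (fun x => u (reflect 0 x))) (hne : ¬ ∀ᵐ x, u x = 0)
    {x : E n} (hx : x ∈ Ω) (hx0 : 0 ≤ x 0) : LocallyPos u x := by
  obtain ⟨ρ, hρ, hρΩ⟩ := Metric.isOpen_iff.1 hD.isOpen x hx
  set l := x 0 + ρ / 4 with hl
  have hn : ‖e₁ n‖ = 1 := by simp [e₁]
  have hy : reflect l x = x + (ρ / 2) • e₁ n := by
    ext i
    by_cases hi : i = 0
    · subst hi; simp [hl]; ring
    · simp [reflect_of_ne _ _ hi, e₁_of_ne hi]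
  have hyΩ : reflect l x ∈ Ω := hρΩ (by
    rw [hy, Metric.mem_ball, dist_eq_norm, add_sub_cancel_left, norm_smul, hn, Real.norm_of_nonneg
      (by positivity)]
    linarith)
  obtain ⟨r, hr, c, hc, h⟩ := hu.locallyPos_of_pos hJ hD hL hu' hne (l := l) (by positivity)
    (x := reflect l x) ⟨hyΩ, by change l < reflect l x 0; rw [reflect_apply_zero]; linarith⟩
  refine ⟨r, hr, c, hc, ?_⟩
  filter_upwards [ae_reflect l h] with z hz hzr
  have h1 := hz (by rw [Metric.mem_ball, dist_reflect]; exact hzr)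
  rw [reflect_reflect] at h1
  linarith [hu.nonneg (reflect l z)]

end IsReflectionSuper

/-! ### Symmetry, strict monotonicity and positivity -/

lemma LocallyPos.comp_reflect {g : E n → ℝ} {x : E n} {l : ℝ} (h : LocallyPos g (reflect l x)) :
    LocallyPos (fun y => g (reflect l y)) x := by
  obtain ⟨r, hr, c, hc, h⟩ := h
  refine ⟨r, hr, c, hc, ?_⟩
  filter_upwards [ae_reflect l h] with z hz hzr
  exact hz (by rw [Metric.mem_ball, dist_reflect]; exact hzr)

lemma EssInfPos.congr {K : Set (E n)} {g g' : E n → ℝ} (h : EssInfPos K g)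
    (hg : g =ᵐ[volume] g') : EssInfPos K g' := by
  obtain ⟨c, hc, h⟩ := h
  refine ⟨c, hc, ?_⟩
  filter_upwards [h, ae_restrict_of_ae hg] with x a b
  rwa [← b]

/-- Solutions of bounded range have a Borel representative with the same bounds everywhere. -/
lemma exists_nice_representative {Ω : Set (E n)} (hΩ : IsOpen Ω) {u : E n → ℝ}
    (hum : AEMeasurable u) (hbdd : MemLp u ⊤ (volume.restrict Ω))
    (hnonneg : ∀ᵐ x ∂(volume.restrict Ω), 0 ≤ u x) (hzero : ∀ᵐ x, x ∉ Ω → u x = 0) :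
    ∃ (M : ℝ) (u' : E n → ℝ), u =ᵐ[volume] u' ∧ Measurable u' ∧ (∀ x, 0 ≤ u' x) ∧
      (∀ x, u' x ≤ M) ∧ ∀ x, x ∉ Ω → u' x = 0 := by
  set M := (eLpNorm u ⊤ (volume.restrict Ω)).toReal with hM
  have hM0 : 0 ≤ M := ENNReal.toReal_nonneg
  have hle : ∀ᵐ x ∂(volume.restrict Ω), u x ≤ M := by
    filter_upwards [ae_le_eLpNormEssSup (f := u) (μ := volume.restrict Ω)] with x hx
    rw [← eLpNorm_exponent_top] at hx
    have h2 := ENNReal.toReal_mono hbdd.2.ne hx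
    rw [toReal_enorm] at h2
    exact (le_abs_self _).trans h2
  rw [ae_restrict_iff' hΩ.measurableSet] at hle hnonneg
  refine ⟨M, Ω.indicator fun x => max 0 (min M (hum.mk u x)), ?_, ?_, fun x =>
    indicator_nonneg (fun _ _ => le_max_left _ _) x, fun x => ?_, fun x hx =>
    indicator_of_notMem hx _⟩
  · filter_upwards [hum.ae_eq_mk, hle, hnonneg, hzero] with x a b c d
    by_cases hx : x ∈ Ω
    · rw [indicator_of_mem hx, ← a, min_eq_right (b hx), max_eq_right (c hx)]
    · rw [indicator_of_notMem hx, d hx]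
  · have := hum.measurable_mk
    exact Measurable.indicator (by fun_prop) hΩ.measurableSet
  · refine indicator_le' (fun _ _ => max_le hM0 (min_le_left _ _)) (fun _ _ => hM0) x

end NonlocalSymmetry

open NonlocalSymmetry in
theorem theorem1p1 {n : ℕ} (J : NonlocalSymmetry.E n → ℝ) (Ω : Set (NonlocalSymmetry.E n))
    (f : NonlocalSymmetry.E n → ℝ → ℝ)
    (hJ : NonlocalSymmetry.IsEvenKernel J)
    (hJ1 : NonlocalSymmetry.CondJ1 J)
    (hJ2 : NonlocalSymmetry.CondJ2 J)
    (hD : NonlocalSymmetry.CondD Ω)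
    (hF1 : NonlocalSymmetry.CondF1 Ω f)
    (hF2 : NonlocalSymmetry.CondF2 Ω f)
    (u : NonlocalSymmetry.E n → ℝ)
    (hbdd : MemLp u ⊤ (volume.restrict Ω))
    (hnonneg : ∀ᵐ x ∂(volume.restrict Ω), 0 ≤ u x)
    (hsol : NonlocalSymmetry.IsSolution J Ω f u) :
    NonlocalSymmetry.IsSymmetric Ω u ∧
      (u =ᵐ[volume] 0 ∨
        (NonlocalSymmetry.IsStrictlyDecreasing Ω u ∧
          ∀ K : Set (NonlocalSymmetry.E n), IsCompact K → K ⊆ Ω →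
            NonlocalSymmetry.EssInfPos K u)) := by
  obtain ⟨J', hJ', hJJ'⟩ := exists_niceKernel hJ hJ1 hJ2
  obtain ⟨M, v, huv, hvm, hv0, hvM, hvz⟩ :=
    exists_nice_representative hD.isOpen hsol.mem.1 hbdd hnonneg hsol.mem.2.2
  have hsol' : IsSolution J' Ω f v := hsol.congr hJJ'.symm huv
  obtain ⟨L, hL, hLip⟩ := hF1.lipschitz (Icc 0 M) (Metric.isBounded_Icc 0 M)
  have hv := hsol'.isReflectionSuper hJ' hD hF2 hLip hvm hv0 hvM hvz
  have hv' := (hsol'.comp_reflect hJ' hD hF2).isReflectionSuper hJ' hD hF2 hLip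
    (hvm.comp (measurable_reflect 0)) (fun x => hv0 _) (fun x => hvM _) fun x hx =>
      hvz _ fun h => hx (by
        have := hD.reflect_zero_mem h
        rwa [reflect_reflect] at this)
  have hv'' : IsReflectionSuper J' Ω L M (fun x => v (reflect 0 (reflect 0 x))) := by
    simpa only [reflect_reflect] using hv
  by_cases hne : ∀ᵐ x, v x = 0
  · have hu0 : ∀ᵐ x, u x = 0 := by
      filter_upwards [huv, hne] with x a b
      rw [a, b]
    refine ⟨ae_restrict_of_ae ?_, Or.inl hu0⟩
    filter_upwards [hu0, ae_reflect 0 hu0] with x a b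
    rw [a]
    simpa [reflect] using b
  have hne' : ¬ ∀ᵐ x, v (reflect 0 x) = 0 := fun h => hne (ae_of_ae_reflect 0 h)
  have hsymm : ∀ᵐ x, v (reflect 0 x) = v x := by
    have h1 := hv.reflectLE_zero hJ' hD hL.le hv' hne
    have h2 := hv'.reflectLE_zero hJ' hD hL.le hv'' hne'
    have h3 : ∀ᵐ x : E n, 0 < x 0 → v (reflect 0 x) = v x := by
      filter_upwards [h1, h2] with x a b h
      have := b h
      rw [reflect_reflect] at this
      exact le_antisymm this (a h)
    filter_upwards [h3, ae_reflect 0 h3, ae_first_ne 0] with x a b c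
    rcases lt_or_gt_of_ne c with h | h
    · rw [reflect_reflect] at b
      exact (b (by simpa using h)).symm
    · exact a h
  refine ⟨ae_restrict_of_ae ?_, Or.inr ⟨fun l hl K hK hKΩ => ?_, fun K hK hKΩ => ?_⟩⟩
  · filter_upwards [huv, ae_reflect 0 huv, hsymm] with x a b c
    rw [a, ← c, ← b]
    simp [reflect]
  · have hvpos : EssInfPos K fun x => v (reflect l x) - v x := by
      refine essInfPos_of_locallyPos hK fun x hx => ?_
      obtain ⟨hxΩ, hxl⟩ := hKΩ hx
      rcases lt_or_gt_of_ne hl with hl | hl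
      · -- for `l < 0` use the reflected solution and the hyperplane `{x₁ = -l}`
        have hxl' : x 0 < l := by rwa [one_lt_div_of_neg hl] at hxl
        have h := hv'.locallyPos_of_pos hJ' hD hL.le hv'' hne' (l := -l) (by linarith)
          (x := reflect 0 x) ⟨hD.reflect_zero_mem hxΩ, by
            change -l < reflect 0 x 0
            rw [reflect_apply_zero]; linarith⟩
        have e : ∀ y : E n, reflect 0 (reflect (-l) (reflect 0 y)) = reflect l y := by
          intro y
          simp only [reflect, withFirst_withFirst, withFirst_zero]
          congr 1; ring
        simpa only [e, reflect_reflect] using h.comp_reflect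
      · exact hv.locallyPos_of_pos hJ' hD hL.le hv' hne hl ⟨hxΩ, (one_lt_div hl).1 hxl⟩
    refine hvpos.congr ?_
    filter_upwards [huv, ae_reflect l huv] with x a b
    rw [a, ← b]
    rfl
  · refine EssInfPos.congr (essInfPos_of_locallyPos hK fun x hx => ?_) huv.symm
    rcases le_total 0 (x 0) with h | h
    · exact hv.locallyPos_self hJ' hD hL.le hv' hne (hKΩ hx) h
    · have h1 := hv'.locallyPos_self hJ' hD hL.le hv'' hne' (hD.reflect_zero_mem (hKΩ hx))
        (by rw [reflect_apply_zero]; linarith)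
      simpa only [reflect_reflect] using h1.comp_reflect
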